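/- Let $V(z,\omega)$, $z\in\mathbb Z$, be i.i.d. random variables with values in $[0,\infty]$ on a probability space $(\Omega,\mathcal F,\mathbb P)$, and let $\kappa,K\in(0,\infty)$ be such that $\mathbb P(V(0,\cdot)\in[\kappa,K])>0$. Call a site $z\in\mathbb Z$ reasonable in the environment $\omega$ if $V(z,\omega)\in[\kappa,K]$. For integers $a=x_0<x_1<\dots<x_m<x_{m+1}=b$, $m\ge 0$, let $\Omega_{(a,b)}(x_1,\dots,x_m)$ be the event that the reasonable sites in $(a,b)$ are exactly $x_1,\dots,x_m$. Let $(S_n)_{n\ge0}$ be the simple symmetric random walk on $\mathbb Z$, with law $P^0$ and expectation $E^0$ when it starts at $0$. For a trajectory let $\tau_y=\inf\{n\ge0: S_n=y\}$ and let $\tau_0^{(2)}$ be the time of its second visit to $0$ (with $\inf\emptyset=\infty$). For $y\ge1$ let $Q_y$ be the probability measure on environments and paths given by $$Q_y(A)=\frac{\mathbb E E^0\big(\mathbf 1_{\{\tau_y<\infty\}}\mathbf 1_A\,e^{-\sum_{n=0}^{\tau_y-1}V(S_n,\omega)}\big)}{\mathbb E E^0\big(\mathbf 1_{\{\tau_y<\infty\}}\,e^{-\sum_{n=0}^{\tau_y-1}V(S_n,\omega)}\big)}.$$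 Given $\omega$, the killed random walk is the Markov chain on $\mathbb Z\cup\{\dagger\}$, with $\dagger$ absorbing, which from $z\in\mathbb Z$ goes to $\dagger$ with probability $1-e^{-V(z,\omega)}$ and otherwise to $z+1$ or $z-1$ with equal probabilities. Let $\check P$ be the joint law of the environment and of the killed random walk started at $0$, averaged over $\mathbb P$, and for $y\ge 1$ let $Q_{0,y}(\cdot)=\check P(\,\cdot\mid \tau_0^{(2)}>\tau_y,\ \tau_y<\infty)$. Then there exist constants $M_1,M_2$ and $\theta\in(0,1)$, not depending on $m$, $a$, $b$, $y$ or $x_1,\dots,x_m$, such that for all $m\ge0$ and all integers $0\le a=x_0<x_1<\dots<x_m<x_{m+1}=b\le y$ $$Q_{0,y}\big(\Omega_{(a,b)}(x_1,\dots,x_m)\big)\le\prod_{j=0}^m\big(M_1\theta^{x_{j+1}-x_j}\big),\qquad Q_y\big(\Omega_{(a,b)}(x_1,\dots,x_m)\big)\le\prod_{j=0}^m\big(M_2\theta^{x_{j+1}-x_j}\big).$$ -/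

import Mathlib

open MeasureTheory ProbabilityTheory
open scoped ENNReal NNReal

noncomputable section

namespace RandomPotential

/-! ### Markov chains on a countable state space -/

section Chain

variable {S : Type*} [MeasurableSpace S]

/-- The one-step kernels of a time-homogeneous Markov chain: the next state is drawn from the
transition kernel at the present state. -/
def stepKernel (p : Kernel S S) (n : ℕ) : Kernel (Finset.Iic n → S) S :=
  p.comap (fun h => h ⟨n, Finset.mem_Iic.2 le_rfl⟩) (by fun_prop)

instance (p : Kernel S S) [IsMarkovKernel p] (n : ℕ) : IsMarkovKernel (stepKernel p n) := by
  unfold stepKernel; infer_instance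

/-- The law, on the space of trajectories, of the Markov chain with transition kernel `p` and
initial state `x`. -/
def chainLaw (p : Kernel S S) [IsMarkovKernel p] (x : S) : Measure (ℕ → S) :=
  Kernel.trajMeasure (X := fun _ => S) (Measure.dirac x) (stepKernel p)

instance (p : Kernel S S) [IsMarkovKernel p] (x : S) : IsProbabilityMeasure (chainLaw p x) := by
  unfold chainLaw; infer_instance

variable [Countable S] [DiscreteMeasurableSpace S]

theorem chainLaw_zero (p : Kernel S S) [IsMarkovKernel p] (x : S) (w : ℕ → S) :
    chainLaw p x {s | ∀ i ≤ 0, s i = w i} = Measure.dirac x {w 0} := by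
  have h0 : {s : ℕ → S | ∀ i ≤ 0, s i = w i} =
      Preorder.frestrictLe (π := fun _ => S) 0 ⁻¹' {h | h ⟨0, by simp⟩ = w 0} := by
    ext s; simp
  have hm : MeasurableSet {h : Finset.Iic 0 → S | h ⟨0, by simp⟩ = w 0} :=
    measurableSet_eq_fun (by fun_prop) measurable_const
  rw [h0, ← Measure.map_apply (by fun_prop) hm, chainLaw, Kernel.trajMeasure,
    Measure.map_comp _ _ (by fun_prop), Kernel.traj_map_frestrictLe, Kernel.partialTraj_self,
    Measure.id_comp, Measure.map_apply (by fun_prop) hm]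
  rfl

theorem chainLaw_succ (p : Kernel S S) [IsMarkovKernel p] (x : S) (w : ℕ → S) (n : ℕ) :
    chainLaw p x {s | ∀ i ≤ n + 1, s i = w i} =
      chainLaw p x {s | ∀ i ≤ n, s i = w i} * p (w n) {w (n + 1)} := by
  set h₀ : Finset.Iic n → S := fun i => w i
  have e1 : {s : ℕ → S | ∀ i ≤ n, s i = w i} =
      Preorder.frestrictLe (π := fun _ => S) n ⁻¹' {h₀} := by
    ext s
    simp [h₀, funext_iff, Preorder.frestrictLe]
  have e2 : {s : ℕ → S | ∀ i ≤ n + 1, s i = w i} =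
      (fun s : ℕ → S => (Preorder.frestrictLe (π := fun _ => S) n s, s (n + 1))) ⁻¹'
        ({h₀} ×ˢ {w (n + 1)}) := by
    ext s
    simp only [Set.mem_ofPred_eq, Set.mem_preimage, Set.mem_prod, Set.mem_singleton_iff,
      Nat.le_succ_iff]
    constructor
    · intro h
      refine ⟨?_, h _ (Or.inr rfl)⟩
      funext i
      exact h _ (Or.inl (Finset.mem_Iic.1 i.2))
    · rintro ⟨h1, h2⟩ i (hi | rfl)
      · exact congrFun h1 ⟨i, Finset.mem_Iic.2 hi⟩
      · exact h2
  have hm : MeasurableSet ({h₀} ×ˢ {w (n + 1)} : Set ((Finset.Iic n → S) × S)) :=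
    (measurableSet_singleton _).prod (measurableSet_singleton _)
  rw [e2, ← Measure.map_apply (by fun_prop) hm, chainLaw,
    ← Kernel.map_frestrictLe_trajMeasure_compProd_eq_map_trajMeasure,
    Measure.compProd_apply_prod (measurableSet_singleton _) (measurableSet_singleton _),
    Measure.restrict_singleton, lintegral_smul_measure, lintegral_dirac,
    Measure.map_apply (by fun_prop) (measurableSet_singleton _), e1]
  rfl

/-- The probability that a Markov chain follows a given finite trajectory. -/
theorem chainLaw_cylinder (p : Kernel S S) [IsMarkovKernel p] (x : S) (w : ℕ → S) (n : ℕ) :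
    chainLaw p x {s | ∀ i ≤ n, s i = w i} =
      Measure.dirac x {w 0} * ∏ i ∈ Finset.range n, p (w i) {w (i + 1)} := by
  induction n with
  | zero => rw [chainLaw_zero, Finset.range_zero, Finset.prod_empty, mul_one]
  | succ n ih => rw [chainLaw_succ, ih, Finset.prod_range_succ, mul_assoc]

/-- If the transition probabilities depend measurably on a parameter, so does the law of the
chain. -/
theorem measurable_chainLaw {Ω : Type*} [MeasurableSpace Ω] (p : Ω → Kernel S S)
    [∀ ω, IsMarkovKernel (p ω)] (hp : ∀ s t, Measurable fun ω => p ω s {t}) (x : S) :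
    Measurable fun ω => chainLaw (p ω) x := by
  refine Measurable.measure_of_isPiSystem_of_isProbabilityMeasure
    (generateFrom_measurableCylinders (α := fun _ : ℕ => S)).symm
    (isPiSystem_measurableCylinders (α := fun _ : ℕ => S)) ?_
  intro A hA
  obtain ⟨I, B, hB, rfl⟩ := (mem_measurableCylinders (α := fun _ : ℕ => S) _).1 hA
  have hI : I ⊆ Finset.Iic (I.sup id) := fun i hi => Finset.mem_Iic.2 (Finset.le_sup (f := id) hi)
  set n := I.sup id
  set C : Set (Finset.Iic n → S) := (fun h i => h ⟨i.1, hI i.2⟩) ⁻¹' B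
  have hC : MeasurableSet C := hB.preimage (by fun_prop)
  have e : cylinder (α := fun _ : ℕ => S) I B = Preorder.frestrictLe (π := fun _ => S) n ⁻¹' C := by
    ext s; rfl
  have key : ∀ ω, chainLaw (p ω) x (cylinder I B) =
      ∑' h, C.indicator (fun h => ((chainLaw (p ω) x).map
        (Preorder.frestrictLe (π := fun _ => S) n)) {h}) h := by
    intro ω
    rw [Measure.tsum_indicator_apply_singleton _ C hC, Measure.map_apply (by fun_prop) hC, e]
  simp_rw [key]
  refine Measurable.tsum fun h => ?_
  by_cases hh : h ∈ C
  swap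
  · simp [hh]
  simp only [Set.indicator_of_mem hh]
  set w : ℕ → S := fun i => if hi : i ≤ n then h ⟨i, Finset.mem_Iic.2 hi⟩ else x
  have ew : Preorder.frestrictLe (π := fun _ => S) n ⁻¹' {h} = {s | ∀ i ≤ n, s i = w i} := by
    ext s
    simp only [Set.mem_preimage, Set.mem_singleton_iff, Set.mem_ofPred_eq]
    constructor
    · rintro rfl i hi
      simp [w, hi]
    · intro hs
      funext i
      have := hs i (Finset.mem_Iic.1 i.2)
      simpa [w, Finset.mem_Iic.1 i.2] using this
  have ec : ∀ ω, ((chainLaw (p ω) x).map (Preorder.frestrictLe (π := fun _ => S) n)) {h} =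
      Measure.dirac x {w 0} * ∏ i ∈ Finset.range n, p ω (w i) {w (i + 1)} := by
    intro ω
    rw [Measure.map_apply (by fun_prop) (measurableSet_singleton _), ew, chainLaw_cylinder]
  simp_rw [ec]
  exact (Finset.measurable_prod _ fun i _ => hp _ _).const_mul _

/-- The time of the first visit of the trajectory `s` to `z`; it is `⊤` if there is none. -/
def hitTime {S : Type*} (s : ℕ → S) (z : S) : ℕ∞ :=
  ⨅ (n : ℕ) (_ : s n = z), (n : ℕ∞)

/-- The time of the second visit of the trajectory `s` to `z`; it is `⊤` if there is none. -/
def secondHitTime {S : Type*} (s : ℕ → S) (z : S) : ℕ∞ :=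
  ⨅ (n : ℕ) (_ : hitTime s z < n ∧ s n = z), (n : ℕ∞)

end Chain

/-! ### Simple random walk and the weighted path measure -/

/-- `e^{-v}` for `v ∈ [0, ∞]`, with `e^{-∞} = 0`. -/
def expNeg (v : ℝ≥0∞) : ℝ≥0∞ := EReal.exp (-(v : EReal))

/-- The transition kernel of the simple symmetric random walk on `ℤ`. -/
def srwKernel : Kernel ℤ ℤ :=
  Kernel.ofFunOfCountable fun z =>
    (2⁻¹ : ℝ≥0∞) • Measure.dirac (z + 1) + (2⁻¹ : ℝ≥0∞) • Measure.dirac (z - 1)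

instance : IsMarkovKernel srwKernel := by
  refine ⟨fun z => ⟨?_⟩⟩
  simp [srwKernel, Kernel.ofFunOfCountable, ENNReal.inv_two_add_inv_two]

/-- The law of the simple symmetric random walk on `ℤ` started at `x`. -/
def srw (x : ℤ) : Measure (ℕ → ℤ) := chainLaw srwKernel x

variable {Ω : Type*} [MeasurableSpace Ω]

open Classical in
/-- The weight `1_{τ_y < ∞} exp (-∑_{n < τ_y} V (S_n, ω))`. -/
def weight (V : ℤ → Ω → ℝ≥0∞) (y : ℤ) (q : Ω × (ℕ → ℤ)) : ℝ≥0∞ :=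
  if hitTime q.2 y < ⊤ then
    expNeg (∑ n ∈ Finset.range (hitTime q.2 y).toNat, V (q.2 n) q.1)
  else 0

/-- The unnormalized annealed measure on environments and paths. -/
def weightedMeasure (P : Measure Ω) (V : ℤ → Ω → ℝ≥0∞) (x y : ℤ) : Measure (Ω × (ℕ → ℤ)) :=
  (P.prod (srw x)).withDensity (weight V y)

/-- The annealed path measure `Q^x_y`, as a measure on environments and paths; the normalizing
constant is the annealed partition function `Z^x_y = 𝔼 Z^{ω,x}_y`. -/
def annealedQ (P : Measure Ω) (V : ℤ → Ω → ℝ≥0∞) (x y : ℤ) : Measure (Ω × (ℕ → ℤ)) :=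
  (weightedMeasure P V x y Set.univ)⁻¹ • weightedMeasure P V x y

/-! ### The killed random walk -/

/-- The state space `ℤ ∪ {†}` of the killed walk, with `†` represented by `none`, is discrete. -/
instance : MeasurableSpace (Option ℤ) := ⊤

instance : DiscreteMeasurableSpace (Option ℤ) := ⟨fun _ => trivial⟩

/-- One step of the killed walk in the potential `v`: from `z` the walk goes to the absorbing
state with probability `1 - e^{-v z}`, and otherwise to one of the two neighbours of `z` with
equal probabilities. -/
def killedStep (v : ℤ → ℝ≥0∞) : Option ℤ → Measure (Option ℤ)
  | none => Measure.dirac none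
  | some z => (1 - expNeg (v z)) • Measure.dirac none +
      expNeg (v z) • ((2⁻¹ : ℝ≥0∞) • Measure.dirac (some (z + 1)) +
        (2⁻¹ : ℝ≥0∞) • Measure.dirac (some (z - 1)))

/-- The transition kernel of the killed walk in the potential `v`. -/
def killedKernel (v : ℤ → ℝ≥0∞) : Kernel (Option ℤ) (Option ℤ) :=
  Kernel.ofFunOfCountable (killedStep v)

theorem expNeg_le_one (v : ℝ≥0∞) : expNeg v ≤ 1 := by
  rw [expNeg, ← EReal.exp_zero]
  exact EReal.exp_monotone (by simpa using EReal.coe_ennreal_nonneg v)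

theorem measurable_expNeg : Measurable expNeg := by
  unfold expNeg
  fun_prop

instance (v : ℤ → ℝ≥0∞) : IsMarkovKernel (killedKernel v) := by
  refine ⟨fun s => ⟨?_⟩⟩
  cases s with
  | none => simp [killedKernel, killedStep, Kernel.ofFunOfCountable]
  | some z =>
    simp [killedKernel, killedStep, Kernel.ofFunOfCountable]
    rw [← mul_add, ENNReal.inv_two_add_inv_two, mul_one, tsub_add_cancel_of_le (expNeg_le_one _)]

/-- The quenched law of the killed walk started at `x`, as a function of the environment. -/
def killedWalk (V : ℤ → Ω → ℝ≥0∞) (hV : ∀ z, Measurable (V z)) (x : ℤ) :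
    Kernel Ω (ℕ → Option ℤ) where
  toFun ω := chainLaw (killedKernel fun z => V z ω) (some x)
  measurable' := by
    refine measurable_chainLaw (fun ω => killedKernel fun z => V z ω) (fun s t => ?_) _
    cases s with
    | none => exact measurable_const
    | some z =>
      have h : Measurable fun ω => expNeg (V z ω) := measurable_expNeg.comp (hV z)
      simp only [killedKernel, killedStep, Kernel.ofFunOfCountable, Kernel.coe_mk,
        Measure.add_apply, Measure.smul_apply, smul_eq_mul]
      fun_prop

instance (V : ℤ → Ω → ℝ≥0∞) (hV : ∀ z, Measurable (V z)) (x : ℤ) :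
    IsMarkovKernel (killedWalk V hV x) :=
  ⟨fun ω => inferInstanceAs
    (IsProbabilityMeasure (chainLaw (killedKernel fun z => V z ω) (some x)))⟩

/-- The averaged law of the killed walk started at `x`, as a measure on environments and
trajectories. -/
def killedAveraged (P : Measure Ω) (V : ℤ → Ω → ℝ≥0∞) (hV : ∀ z, Measurable (V z)) (x : ℤ) :
    Measure (Ω × (ℕ → Option ℤ)) :=
  P ⊗ₘ killedWalk V hV x

/-- The measure `Q_{x,y}`: the averaged killed walk started at `x`, conditioned on hitting `y`
before its second visit to `x`. -/
def bridgeQ (P : Measure Ω) (V : ℤ → Ω → ℝ≥0∞) (hV : ∀ z, Measurable (V z)) (x y : ℤ) :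
    Measure (Ω × (ℕ → Option ℤ)) :=
  ProbabilityTheory.cond (killedAveraged P V hV x)
    {q | hitTime q.2 (some y) < secondHitTime q.2 (some x) ∧ hitTime q.2 (some y) < ⊤}

/-! ### Reasonable sites -/

/-- The event that, among the sites of `I`, exactly those of `X ⊆ I` are reasonable, that is,
carry a potential in `[κ, K]`. -/
def reasonableExactly (V : ℤ → Ω → ℝ≥0∞) (κ K : ℝ≥0) (I X : Set ℤ) : Set Ω :=
  {ω | (∀ z ∈ X, V z ω ∈ Set.Icc (κ : ℝ≥0∞) K) ∧
    ∀ z ∈ I \ X, V z ω ∉ Set.Icc (κ : ℝ≥0∞) K}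

end RandomPotential

end

noncomputable section

namespace RandomPotential

/-! ### Crossing weights of nearest-neighbour paths -/

section Crossing

/-! A bridge from `x` to `x + n` is a path that does not return to `x`, and its weight factorises
into crossing ratios obeying r ↦ e / (1 - e r). The killed walk meets the conditioning in `bridgeQ`
with probability equal to the bridge weight (`chainLaw_killed_bridge`), so the first bound compares
annealed bridge weights with and without the prescribed environment.

Bridges concatenate, hence their weights are supermultiplicative (`bridge_mul_le`). Conversely, a
bridge can be cut at an intermediate site at a cost controlled by the returns to that site. The cost
is bounded at a site with killing at least κ (`bridge_add_le_of_killing`), and at most 2a at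
distance a from the start in any environment (`bridge_add_le`).

The heart is the decay of long gaps without reasonable sites. Let β(n) be the annealed bridge weight
and h(L, n) its part with no reasonable site in (0, L). Locating the first reasonable site gives ∑ q
h(l, l) β(n - l) ≤ β(n) with q = e^{-K} ℙ(reasonable), because a reasonable site costs at most
e^{-K}. Cutting a gap gives h(l + L, l + n) ≤ 2l h(l, l) h(L, n). As ∑ 1/l diverges, there are N and
θ < 1 with ∑_{l ≤ N} q θ^l / (2l) ≥ 1. Averaging the cut over l with these weights gives by
induction h(L, n) ≤ θ^{-N} θ^L β(n) (`gap_decay`).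

Several gaps are cut apart at the prescribed reasonable sites at bounded cost, are independent, and
reassemble by supermultiplicativity of β (`lintegral_patternBridge_le`). A start at 0 instead of `a`
is handled by cutting at the last reasonable site up to `a`; the sum over its position is geometric
(`lintegral_patternBridge_zero_le`).

For the weighted walk, excursions to the left of 0 must also be controlled. If the first reasonable
site on the left is -(k + 1), they cost a factor linear in k (`harmonic_le_bridge`). This k is
independent of the environment on the right and has a geometric tail, so the annealed cost is a
constant (`exists_lintegral_partition_le`). -/

/-- The weight of crossing from `x + k` to `x + k + 1`, when the weight of crossing from `x` to
`x + 1` is `t` and a step out of `z`, in either direction, has weight `e z`. -/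
def crossRatio (e : ℤ → ℝ) (t : ℝ) (x : ℤ) : ℕ → ℝ
  | 0 => t
  | k + 1 => e (x + k + 1) / (1 - e (x + k + 1) * crossRatio e t x k)

/-- The factors of `bridge`. -/
def bridgeFactor (e : ℤ → ℝ) (x : ℤ) : ℕ → ℝ
  | 0 => e x
  | k + 1 => crossRatio e 0 x (k + 1)

/-- The total weight of the paths that go from `x` to `x + n` without returning to `x`. -/
def bridge (e : ℤ → ℝ) (x : ℤ) (n : ℕ) : ℝ :=
  ∏ k ∈ Finset.range n, bridgeFactor e x k

variable {e : ℤ → ℝ}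

theorem step_denom_pos {a r : ℝ} (ha : 0 ≤ a) (ha' : a ≤ 1 / 2) (hr : r < 1) :
    0 < 1 - a * r := by
  nlinarith

theorem step_ratio_nonneg {a r : ℝ} (ha : 0 ≤ a) (ha' : a ≤ 1 / 2) (hr : r < 1) :
    0 ≤ a / (1 - a * r) :=
  div_nonneg ha (step_denom_pos ha ha' hr).le

theorem step_ratio_lt_one {a r : ℝ} (ha : 0 ≤ a) (ha' : a ≤ 1 / 2) (hr : r < 1) :
    a / (1 - a * r) < 1 := by
  rw [div_lt_one (step_denom_pos ha ha' hr)]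
  rcases ha.eq_or_lt with rfl | ha0
  · norm_num
  · nlinarith [mul_pos ha0 (sub_pos.2 hr)]

theorem step_ratio_mono {a r s : ℝ} (ha : 0 ≤ a) (ha' : a ≤ 1 / 2) (hs : s < 1) (hrs : r ≤ s) :
    a / (1 - a * r) ≤ a / (1 - a * s) := by
  have := step_denom_pos ha ha' hs
  gcongr

theorem crossRatio_mem (he0 : ∀ z, 0 ≤ e z) (he : ∀ z, e z ≤ 1 / 2) {t : ℝ} (ht0 : 0 ≤ t)
    (ht : t < 1) (x : ℤ) (k : ℕ) : 0 ≤ crossRatio e t x k ∧ crossRatio e t x k < 1 := by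
  induction k with
  | zero => exact ⟨ht0, ht⟩
  | succ k ih =>
    exact ⟨step_ratio_nonneg (he0 _) (he _) ih.2, step_ratio_lt_one (he0 _) (he _) ih.2⟩

theorem crossRatio_mono (he0 : ∀ z, 0 ≤ e z) (he : ∀ z, e z ≤ 1 / 2) {s t : ℝ} (hs : 0 ≤ s)
    (hst : s ≤ t) (ht : t < 1) (x : ℤ) (k : ℕ) : crossRatio e s x k ≤ crossRatio e t x k := by
  induction k with
  | zero => exact hst
  | succ k ih =>
    exact step_ratio_mono (he0 _) (he _) (crossRatio_mem he0 he (hs.trans hst) ht x k).2 ih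

/-- Markov property: the ratio at `x + a` contains all that matters about the sites to its left. -/
theorem crossRatio_add (t : ℝ) (x : ℤ) (a k : ℕ) :
    crossRatio e t x (a + k) = crossRatio e (crossRatio e t x a) (x + a) k := by
  induction k with
  | zero => rfl
  | succ k ih =>
    rw [← add_assoc, crossRatio, crossRatio, ih]
    push_cast
    rw [add_assoc x (a : ℤ)]

/-- The extremal case is the walk without killing, `e = 1/2`, where the recursion r ↦ 1 / (2 - r)
sends 1 - 1/l exactly to 1 - 1/(l + 1). For `l = 1` this is gambler's ruin. -/
theorem crossRatio_le (he0 : ∀ z, 0 ≤ e z) (he : ∀ z, e z ≤ 1 / 2) {t l : ℝ} (hl : 0 < l)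
    (ht0 : 0 ≤ t) (ht : t ≤ 1 - 1 / l) (x : ℤ) (k : ℕ) :
    crossRatio e t x k ≤ 1 - 1 / (l + k) := by
  induction k with
  | zero => simpa [crossRatio] using ht
  | succ k ih =>
    have hlk : 0 < l + k := by positivity
    have h1 : 1 / (l + k) > 0 := by positivity
    have hr0 := (crossRatio_mem he0 he ht0 (by have : 0 < 1 / l := by positivity
                                               linarith) x k).1
    rw [crossRatio]
    set r := crossRatio e t x k
    have hr1 : r < 1 := by linarith
    rw [div_le_iff₀ (step_denom_pos (he0 _) (he _) hr1)]
    set a := e (x + k + 1)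
    have ha0 : 0 ≤ a := he0 _
    have ha : a ≤ 1 / 2 := he _
    have h2 : r * (l + k) ≤ l + k - 1 := by
      calc r * (l + k) ≤ (1 - 1 / (l + k)) * (l + k) := by gcongr
        _ = l + k - 1 := by field_simp
    push_cast
    have h3 : 1 - 1 / (l + (k + 1)) = (l + k) / (l + k + 1) := by field_simp; ring
    rw [h3, div_mul_eq_mul_div, le_div_iff₀ (by positivity)]
    nlinarith

theorem bridgeFactor_nonneg (he0 : ∀ z, 0 ≤ e z) (he : ∀ z, e z ≤ 1 / 2) (x : ℤ) (k : ℕ) :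
    0 ≤ bridgeFactor e x k := by
  cases k with
  | zero => exact he0 x
  | succ k => exact (crossRatio_mem he0 he le_rfl one_pos x (k + 1)).1

theorem bridge_nonneg (he0 : ∀ z, 0 ≤ e z) (he : ∀ z, e z ≤ 1 / 2) (x : ℤ) (n : ℕ) :
    0 ≤ bridge e x n :=
  Finset.prod_nonneg fun k _ => bridgeFactor_nonneg he0 he x k

theorem bridge_le_one (he0 : ∀ z, 0 ≤ e z) (he : ∀ z, e z ≤ 1 / 2) (x : ℤ) (n : ℕ) :
    bridge e x n ≤ 1 := by
  refine Finset.prod_le_one (fun k _ => bridgeFactor_nonneg he0 he x k) fun k _ => ?_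
  cases k with
  | zero => exact (he x).trans (by norm_num)
  | succ k => exact (crossRatio_mem he0 he le_rfl one_pos x (k + 1)).2.le

/-- A bridge restarted at `x + a` may not use the sites to the left of its new start, which can only
lower its ratios. -/
theorem bridgeFactor_add_ge (he0 : ∀ z, 0 ≤ e z) (he : ∀ z, e z ≤ 1 / 2) (x : ℤ) (a k : ℕ) :
    bridgeFactor e (x + a) k ≤ bridgeFactor e x (a + k) := by
  cases a with
  | zero => simp
  | succ a =>
    have hm := crossRatio_mem he0 he le_rfl one_pos x a
    cases k with
    | zero =>
      have h := step_ratio_mono (he0 (x + a + 1)) (he _) hm.2 hm.1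
      simpa [bridgeFactor, crossRatio, add_assoc] using h
    | succ k =>
      rw [bridgeFactor, ← add_assoc, bridgeFactor, add_assoc (a + 1) k 1,
        crossRatio_add 0 x (a + 1)]
      have hm' := crossRatio_mem he0 he le_rfl one_pos x (a + 1)
      exact crossRatio_mono he0 he le_rfl hm'.1 hm'.2 _ _

/-- Two consecutive bridges concatenate to a bridge. -/
theorem bridge_mul_le (he0 : ∀ z, 0 ≤ e z) (he : ∀ z, e z ≤ 1 / 2) (x : ℤ) (a b : ℕ) :
    bridge e x a * bridge e (x + a) b ≤ bridge e x (a + b) := by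
  rw [bridge, bridge, bridge, Finset.prod_range_add]
  refine mul_le_mul_of_nonneg_left ?_ (bridge_nonneg he0 he x a)
  exact Finset.prod_le_prod (fun k _ => bridgeFactor_nonneg he0 he _ k)
    fun k _ => bridgeFactor_add_ge he0 he x a k

/-- Starting the crossing weights from `t` instead of from a killed walk costs at most a factor
`C`, if the escape weight at the starting site is large enough. -/
theorem prod_crossRatio_le (he0 : ∀ z, 0 ≤ e z) (he : ∀ z, e z ≤ 1 / 2) {t C : ℝ} {x : ℤ}
    (ht0 : 0 ≤ t) (ht : t < 1) (hC0 : 0 ≤ C) (hC : t ≤ C * e x * (1 - t)) (n : ℕ) :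
    ∏ k ∈ Finset.range (n + 1), crossRatio e t x k ≤ C * bridge e x (n + 1) := by
  -- The claim is strengthened by the escape factors `1 - crossRatio` on both sides: `hC` is then
  -- its base case, and since ratios started from `t` dominate those started from `0`, the factors
  -- can be cancelled at the end.
  suffices h : (∏ k ∈ Finset.range (n + 1), crossRatio e t x k) * (1 - crossRatio e 0 x n) ≤
      C * bridge e x (n + 1) * (1 - crossRatio e t x n) by
    have h1 := crossRatio_mono he0 he le_rfl ht0 ht x n
    have h2 := crossRatio_mem he0 he le_rfl one_pos x n
    have h3 : 0 ≤ C * bridge e x (n + 1) := mul_nonneg hC0 (bridge_nonneg he0 he _ _)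
    have h4 := h.trans (mul_le_mul_of_nonneg_left (sub_le_sub_left h1 1) h3)
    exact le_of_mul_le_mul_right h4 (by linarith)
  induction n with
  | zero => simpa [crossRatio, bridge, bridgeFactor] using hC
  | succ n ih =>
    have hbr : bridge e x (n + 1 + 1) = bridge e x (n + 1) * crossRatio e 0 x (n + 1) :=
      Finset.prod_range_succ _ _
    rw [Finset.prod_range_succ, hbr]
    set N := ∏ k ∈ Finset.range (n + 1), crossRatio e t x k
    set B := bridge e x (n + 1)
    have hB : 0 ≤ B := bridge_nonneg he0 he _ _
    have h1 := crossRatio_mono he0 he le_rfl ht0 ht x n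
    have h2 := crossRatio_mem he0 he le_rfl one_pos x n
    have h3 := crossRatio_mem he0 he ht0 ht x n
    have hNB : N ≤ C * B := by
      have h4 := ih.trans (mul_le_mul_of_nonneg_left (sub_le_sub_left h1 1) (mul_nonneg hC0 hB))
      exact le_of_mul_le_mul_right h4 (by linarith)
    rw [crossRatio, crossRatio]
    set r := crossRatio e t x n
    set s := crossRatio e 0 x n
    set a := e (x + n + 1)
    have ha0 : 0 ≤ a := he0 _
    have ha : a ≤ 1 / 2 := he _
    have d1 := step_denom_pos ha0 ha h3.2
    have d2 := step_denom_pos ha0 ha h2.2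
    have e1 : N * (a / (1 - a * r)) * (1 - a / (1 - a * s)) =
        a / ((1 - a * r) * (1 - a * s)) * (N * (1 - a * s - a)) := by
      field_simp
    have e2 : C * (B * (a / (1 - a * s))) * (1 - a / (1 - a * r)) =
        a / ((1 - a * r) * (1 - a * s)) * (C * B * (1 - a * r - a)) := by
      field_simp
    rw [e1, e2]
    refine mul_le_mul_of_nonneg_left ?_ (by positivity)
    -- Both sides become combinations with the nonnegative coefficients `1 - 2 * a` and `a`; the
    -- first parts are compared by `hNB`, the second by the induction hypothesis.
    have e3 : N * (1 - a * s - a) = N * (1 - 2 * a) + a * (N * (1 - s)) := by ring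
    have e4 : C * B * (1 - a * r - a) = C * B * (1 - 2 * a) + a * (C * B * (1 - r)) := by ring
    rw [e3, e4]
    have : 0 ≤ 1 - 2 * a := by linarith
    gcongr

theorem step_ratio_le_escape {a r C : ℝ} (ha : 0 ≤ a) (ha' : a ≤ 1 / 2) (hr : r < 1)
    (hC : 1 ≤ C * (1 - a * (1 + r))) :
    a / (1 - a * r) ≤ C * a * (1 - a / (1 - a * r)) := by
  have d := step_denom_pos ha ha' hr
  have : C * a * (1 - a / (1 - a * r)) = a / (1 - a * r) * (C * (1 - a * (1 + r))) := by
    field_simp; ring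
  rw [this]
  exact le_mul_of_one_le_right (by positivity) hC

/-- Beyond the site `x + a + 1` the factors of the bridge are crossing ratios started from its own
ratio there, and `prod_crossRatio_le` compares these with a fresh bridge. The bracket in `hC` is the
weight lost at that site: neither a step to the right nor a return from the left. -/
theorem bridge_add_le_of_escape (he0 : ∀ z, 0 ≤ e z) (he : ∀ z, e z ≤ 1 / 2) {C : ℝ}
    (hC0 : 0 ≤ C) (x : ℤ) (a b : ℕ)
    (hC : 1 ≤ C * (1 - e (x + a + 1) * (1 + crossRatio e 0 x a))) :
    bridge e x (a + 1 + (b + 1)) ≤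
      C * (bridge e x (a + 1) * bridge e (x + (a + 1 : ℕ)) (b + 1)) := by
  have hm := crossRatio_mem he0 he le_rfl one_pos x a
  have hm' := crossRatio_mem he0 he le_rfl one_pos x (a + 1)
  have key := prod_crossRatio_le he0 he (t := crossRatio e 0 x (a + 1)) (C := C)
    (x := x + (a + 1 : ℕ)) hm'.1 hm'.2 hC0 (by
      have := step_ratio_le_escape (he0 (x + a + 1)) (he _) hm.2 hC
      simpa [crossRatio, add_assoc] using this) b
  have e1 : bridge e x (a + 1 + (b + 1)) = bridge e x (a + 1) *
      ∏ k ∈ Finset.range (b + 1),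
        crossRatio e (crossRatio e 0 x (a + 1)) (x + (a + 1 : ℕ)) k := by
    rw [bridge, Finset.prod_range_add, ← bridge]
    congr 1
    refine Finset.prod_congr rfl fun k _ => ?_
    rw [← crossRatio_add, show a + 1 + k = a + k + 1 by ring, bridgeFactor]
  rw [e1, mul_left_comm]
  exact mul_le_mul_of_nonneg_left key (bridge_nonneg he0 he _ _)

/-- A bridge splits at each of its sites at a cost of twice the distance from its start. -/
theorem bridge_add_le (he0 : ∀ z, 0 ≤ e z) (he : ∀ z, e z ≤ 1 / 2) (x : ℤ) {a b : ℕ}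
    (ha : 1 ≤ a) (hb : 1 ≤ b) :
    bridge e x (a + b) ≤ 2 * a * (bridge e x a * bridge e (x + a) b) := by
  obtain ⟨a, rfl⟩ := Nat.exists_eq_add_of_le' ha
  obtain ⟨b, rfl⟩ := Nat.exists_eq_add_of_le' hb
  refine bridge_add_le_of_escape he0 he (by positivity) x a b ?_
  have h := crossRatio_le he0 he one_pos le_rfl (by norm_num) x a
  have hm := crossRatio_mem he0 he le_rfl one_pos x a
  set r := crossRatio e 0 x a
  have h1 : e (x + a + 1) * (1 + r) ≤ 1 / 2 * (1 + (1 - 1 / (1 + a))) := by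
    have := he0 (x + a + 1)
    have := he (x + a + 1)
    gcongr
    linarith
  have h2 : (2 * ((a + 1 : ℕ) : ℝ)) * (1 - 1 / 2 * (1 + (1 - 1 / (1 + a)))) = 1 := by
    push_cast
    field_simp
    ring
  calc (1 : ℝ) = (2 * ((a + 1 : ℕ) : ℝ)) * (1 - 1 / 2 * (1 + (1 - 1 / (1 + a)))) := h2.symm
    _ ≤ (2 * ((a + 1 : ℕ) : ℝ)) * (1 - e (x + a + 1) * (1 + r)) := by gcongr

/-- A bridge splits at a site with killing at a bounded cost. -/
theorem bridge_add_le_of_killing (he0 : ∀ z, 0 ≤ e z) (he : ∀ z, e z ≤ 1 / 2) (x : ℤ) {a b : ℕ}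
    {g : ℝ} (hg : 0 ≤ g) (ha : 1 ≤ a) (hb : 1 ≤ b) (hx : 1 ≤ g * (1 - 2 * e (x + a))) :
    bridge e x (a + b) ≤ g * (bridge e x a * bridge e (x + a) b) := by
  obtain ⟨a, rfl⟩ := Nat.exists_eq_add_of_le' ha
  obtain ⟨b, rfl⟩ := Nat.exists_eq_add_of_le' hb
  refine bridge_add_le_of_escape he0 he hg x a b (hx.trans ?_)
  have hm := crossRatio_mem he0 he le_rfl one_pos x a
  have := he0 (x + a + 1)
  push_cast
  rw [← add_assoc]
  exact mul_le_mul_of_nonneg_left (by nlinarith) hg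

/-! ### Harmonic functions -/

/-- Elimination from left to right: inserting the bound on `Z (x + k)` into the inequality at the
next site and solving for the value there reproduces the recursion of `crossRatio`. -/
theorem le_crossRatio_mul {Z : ℤ → ℝ} (he0 : ∀ z, 0 ≤ e z) (he : ∀ z, e z ≤ 1 / 2) {t : ℝ}
    {x y : ℤ} (ht0 : 0 ≤ t) (ht : t < 1) (hx : Z x ≤ t * Z (x + 1))
    (hZ : ∀ z, x < z → z < y → Z z ≤ e z * (Z (z - 1) + Z (z + 1))) (k : ℕ) (hk : x + k < y) :
    Z (x + k) ≤ crossRatio e t x k * Z (x + k + 1) := by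
  induction k with
  | zero => simpa [crossRatio] using hx
  | succ k ih =>
    push_cast at hk ⊢
    have h1 := ih (by linarith)
    have h2 := hZ (x + k + 1) (by linarith) (by linarith)
    have d := step_denom_pos (he0 (x + k + 1)) (he _) (crossRatio_mem he0 he ht0 ht x k).2
    rw [← add_assoc, crossRatio, div_mul_eq_mul_div, le_div_iff₀ d]
    rw [show x + (k : ℤ) + 1 - 1 = x + k by ring] at h2
    nlinarith [mul_le_mul_of_nonneg_left h1 (he0 (x + k + 1))]

theorem crossRatio_mul_le {Z : ℤ → ℝ} (he0 : ∀ z, 0 ≤ e z) (he : ∀ z, e z ≤ 1 / 2) {t : ℝ}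
    {x y : ℤ} (ht0 : 0 ≤ t) (ht : t < 1) (hx : t * Z (x + 1) ≤ Z x)
    (hZ : ∀ z, x < z → z < y → e z * (Z (z - 1) + Z (z + 1)) ≤ Z z) (k : ℕ) (hk : x + k < y) :
    crossRatio e t x k * Z (x + k + 1) ≤ Z (x + k) := by
  have := le_crossRatio_mul (Z := fun z => -Z z) he0 he ht0 ht (by linarith)
    (fun z h1 h2 => by linarith [hZ z h1 h2]) k hk
  linarith

/-- The hitting probability of `y` before `0` is given by the crossing weights. -/
theorem bridge_eq_of_harmonic {h : ℤ → ℝ} (he0 : ∀ z, 0 ≤ e z) (he : ∀ z, e z ≤ 1 / 2) (n : ℕ)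
    (h0 : h 0 = 0) (hn : h (n + 1 : ℕ) = 1)
    (hh : ∀ z : ℤ, 0 < z → z < (n + 1 : ℕ) → h z = e z * (h (z - 1) + h (z + 1))) :
    e 0 * h 1 = bridge e 0 (n + 1) := by
  suffices H : ∀ k ≤ n, e 0 * h 1 = bridge e 0 (k + 1) * h (k + 1 : ℕ) by
    rw [H n le_rfl, hn, mul_one]
  intro k hk
  induction k with
  | zero => simp [bridge, bridgeFactor]
  | succ k ih =>
    rw [ih (by omega), bridge, bridge, Finset.prod_range_succ _ (k + 1), bridgeFactor, mul_assoc]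
    congr 1
    have hk' : (0 : ℤ) + (k + 1 : ℕ) < (n + 1 : ℕ) := by push_cast; omega
    have l1 := le_crossRatio_mul he0 he le_rfl one_pos (by simp [h0])
      (fun z h1 h2 => (hh z h1 h2).le) (k + 1) hk'
    have l2 := crossRatio_mul_le he0 he le_rfl one_pos (by simp [h0])
      (fun z h1 h2 => (hh z h1 h2).ge) (k + 1) hk'
    have := le_antisymm l1 l2
    push_cast at this ⊢
    simpa using this

/-- Ratios started from `0` ignore everything to the left of the start, so they bound `Z z / Z (z +
1)` from below; this gives the lower bound on the partition function. -/
theorem bridge_le_of_harmonic {Z : ℤ → ℝ} (he0 : ∀ z, 0 ≤ e z) (he : ∀ z, e z ≤ 1 / 2) {n : ℕ}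
    (hZ0 : ∀ z, 0 ≤ Z z) (hn : Z n = 1)
    (hZ : ∀ z : ℤ, z < n → Z z = e z * (Z (z - 1) + Z (z + 1))) :
    bridge e 0 n ≤ Z 0 := by
  suffices H : ∀ k ≤ n, bridge e 0 k * Z k ≤ Z 0 by simpa [hn] using H n le_rfl
  intro k hk
  induction k with
  | zero => simp [bridge]
  | succ k ih =>
    refine le_trans ?_ (ih (by omega))
    rw [bridge, Finset.prod_range_succ, ← bridge, mul_assoc]
    refine mul_le_mul_of_nonneg_left ?_ (bridge_nonneg he0 he _ _)
    cases k with
    | zero =>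
      have h := hZ 0 (by exact_mod_cast hk)
      have := mul_nonneg (he0 0) (hZ0 (0 - 1))
      simp only [bridgeFactor, Nat.cast_zero, zero_add, Nat.cast_one]
      simp only [zero_add] at h
      linarith [h]
    | succ k =>
      have := crossRatio_mul_le (y := n) he0 he le_rfl one_pos (by simpa using hZ0 0)
        (fun z _ h2 => (hZ z h2).ge) (k + 1) (by push_cast; omega)
      simpa [bridgeFactor] using this

/-- A bounded nonnegative function that is harmonic to the left of `y` is nondecreasing there. -/
theorem harmonic_le_succ {Z : ℤ → ℝ} (he : ∀ z, e z ≤ 1 / 2) {y : ℤ}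
    (hZ0 : ∀ z, 0 ≤ Z z) (hZ1 : ∀ z, Z z ≤ 1)
    (hZ : ∀ z, z < y → Z z = e z * (Z (z - 1) + Z (z + 1))) {z : ℤ} (hz : z < y) :
    Z z ≤ Z (z + 1) := by
  by_contra! hlt
  set d := Z z - Z (z + 1)
  have hd : 0 < d := sub_pos.2 hlt
  -- Since `2 * e w ≤ 1`, `Z` is convex to the left of `y`. A strict decrease by `d` at `z` then
  -- persists at every site further left, which contradicts boundedness.
  have conv : ∀ w, w < y → Z w - Z (w + 1) ≤ Z (w - 1) - Z w := by
    intro w hw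
    have := hZ w hw
    nlinarith [he w, hZ0 (w - 1), hZ0 (w + 1)]
  have hstep : ∀ k : ℕ, d ≤ Z (z - k) - Z (z - k + 1) := by
    intro k
    induction k with
    | zero => simp [d]
    | succ k ih =>
      have := conv (z - k) (by linarith)
      push_cast
      rw [show z - ((k : ℤ) + 1) + 1 = z - k by ring, show z - ((k : ℤ) + 1) = z - k - 1 by ring]
      linarith
  have hsum : ∀ k : ℕ, k * d ≤ Z (z - k + 1) := by
    intro k
    induction k with
    | zero => simpa using hZ0 (z + 1)
    | succ k ih =>
      have := hstep k
      push_cast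
      rw [show z - ((k : ℤ) + 1) + 1 = z - k by ring]
      linarith
  obtain ⟨k, hk⟩ := exists_nat_gt (1 / d)
  rw [div_lt_iff₀ hd] at hk
  linarith [hsum k, hZ1 (z - k + 1)]

/-- If the site `-k` has killing, the walk may be conditioned not to return to its start at a cost
linear in `k`. -/
theorem harmonic_le_bridge {Z : ℤ → ℝ} (he0 : ∀ z, 0 ≤ e z) (he : ∀ z, e z ≤ 1 / 2) {n k : ℕ}
    {g : ℝ} (hg : 0 < g) (hZ0 : ∀ z, 0 ≤ Z z) (hZ1 : ∀ z, Z z ≤ 1) (hn : Z (n + 1 : ℕ) = 1)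
    (hZ : ∀ z : ℤ, z < (n + 1 : ℕ) → Z z = e z * (Z (z - 1) + Z (z + 1)))
    (hk : 1 ≤ g * (1 - 2 * e (-(k + 1 : ℕ)))) :
    Z 0 ≤ 2 * (g + k) * bridge e 0 (n + 1) := by
  set u : ℤ := -(k + 1 : ℕ) with hu
  have hu0 : u + (k + 1 : ℕ) = 0 := by omega
  have hgk : 1 / g ≤ 1 - 2 * e u := by rwa [div_le_iff₀' hg]
  have hginv : 0 < 1 / g := by positivity
  -- The value of the recursion with ratio `1` to the left of `u`, which is legitimate as `Z` is
  -- nondecreasing. The killing at `u` makes it at most `1 - 1 / g`.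
  set t := e u / (1 - e u)
  have hd : 0 < 1 - e u := by linarith [he u]
  have ht0 : 0 ≤ t := div_nonneg (he0 u) hd.le
  have ht : t ≤ 1 - 1 / g := by
    rw [div_le_iff₀ hd]
    nlinarith [he0 u]
  have ht1 : t < 1 := by linarith
  have hux : Z u ≤ t * Z (u + 1) := by
    have h1 := hZ u (by omega)
    have h2 := harmonic_le_succ he hZ0 hZ1 hZ (z := u - 1) (by omega)
    rw [sub_add_cancel] at h2
    rw [div_mul_eq_mul_div, le_div_iff₀ hd]
    nlinarith [he0 u]
  -- From `u = -(k + 1)` it is `k` steps to `-1`, so the ratio there is at most `1 - 1 / (g + k)`;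
  -- the weight lost at `0` is then at least `1 / (2 * (g + k))`.
  have hs := crossRatio_le he0 he hg ht0 ht u k
  have hm := crossRatio_mem he0 he ht0 ht1 u k
  have hm' := crossRatio_mem he0 he ht0 ht1 u (k + 1)
  have hprod : Z 0 ≤ ∏ i ∈ Finset.range (n + 1), crossRatio e (crossRatio e t u (k + 1)) 0 i := by
    suffices H : ∀ j ≤ n + 1, Z 0 ≤
        (∏ i ∈ Finset.range j, crossRatio e (crossRatio e t u (k + 1)) 0 i) * Z j by
      simpa only [hn, mul_one] using H (n + 1) le_rfl
    intro j hj
    induction j with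
    | zero => simp
    | succ j ih =>
      refine (ih (by omega)).trans ?_
      rw [Finset.prod_range_succ, mul_assoc]
      refine mul_le_mul_of_nonneg_left ?_
        (Finset.prod_nonneg fun i _ => (crossRatio_mem he0 he hm'.1 hm'.2 0 i).1)
      have := le_crossRatio_mul he0 he ht0 ht1 hux (fun z _ h2 => (hZ z h2).le)
        (k + 1 + j) (by push_cast at hu0 hj ⊢; omega)
      rw [crossRatio_add, hu0] at this
      have e1 : u + ((k + 1 + j : ℕ) : ℤ) = j := by push_cast at hu0 ⊢; omega
      rw [e1] at this
      exact_mod_cast this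
  refine hprod.trans (prod_crossRatio_le he0 he hm'.1 hm'.2 (by positivity) ?_ n)
  have e0 : u + k + 1 = 0 := by push_cast at hu0; omega
  rw [crossRatio, e0]
  refine step_ratio_le_escape (he0 0) (he 0) hm.2 ?_
  set r := crossRatio e t u k
  have h1 : e 0 * (1 + r) ≤ 1 / 2 * (1 + (1 - 1 / (g + k))) := by
    have := he0 0
    have := he 0
    gcongr
    linarith
  have h2 : 2 * (g + k) * (1 - 1 / 2 * (1 + (1 - 1 / (g + k)))) = 1 := by
    field_simp
    ring
  calc (1 : ℝ) = 2 * (g + k) * (1 - 1 / 2 * (1 + (1 - 1 / (g + k)))) := h2.symm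
    _ ≤ 2 * (g + k) * (1 - e 0 * (1 + r)) := by gcongr

end Crossing

/-! ### First-step analysis -/

section FirstStep

variable {S : Type*}

/-- The trajectory that starts at `x` and then follows `s`. -/
def consPath (x : S) (s : ℕ → S) : ℕ → S
  | 0 => x
  | n + 1 => s n

theorem hitTime_eq_of_first {s : ℕ → S} {z : S} {n : ℕ} (hn : s n = z) (h : ∀ m < n, s m ≠ z) :
    hitTime s z = n := by
  refine le_antisymm (iInf₂_le n hn) (le_iInf₂ fun m hm => ?_)
  exact_mod_cast not_lt.1 fun hlt => h m hlt hm

theorem exists_hitTime_eq {s : ℕ → S} {z : S} (h : hitTime s z ≠ ⊤) :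
    ∃ n : ℕ, s n = z ∧ hitTime s z = n := by
  classical
  have hex : ∃ n, s n = z := by
    by_contra! hne
    exact h (by simp [hitTime, hne])
  exact ⟨Nat.find hex, Nat.find_spec hex,
    hitTime_eq_of_first (Nat.find_spec hex) fun m hm => Nat.find_min hex hm⟩

theorem hitTime_consPath_self (x : S) (s : ℕ → S) : hitTime (consPath x s) x = 0 :=
  hitTime_eq_of_first (n := 0) rfl (by simp)

theorem hitTime_consPath_of_ne {x z : S} (h : x ≠ z) (s : ℕ → S) :
    hitTime (consPath x s) z = hitTime s z + 1 := by
  refine le_antisymm ?_ (le_iInf₂ fun n hn => ?_)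
  · by_cases ht : hitTime s z = ⊤
    · simp [ht]
    · obtain ⟨n, hn, he⟩ := exists_hitTime_eq ht
      rw [he]
      exact_mod_cast iInf₂_le (n + 1) hn
  · cases n with
    | zero => exact absurd hn h
    | succ n =>
      have : hitTime s z ≤ n := iInf₂_le n hn
      push_cast
      gcongr

theorem secondHitTime_consPath_self (x : S) (s : ℕ → S) :
    secondHitTime (consPath x s) x = hitTime s x + 1 := by
  refine le_antisymm ?_ (le_iInf₂ fun n hn => ?_)
  · by_cases ht : hitTime s x = ⊤
    · simp [ht]
    · obtain ⟨n, hn, he⟩ := exists_hitTime_eq ht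
      rw [he]
      have h1 : hitTime (consPath x s) x < (n + 1 : ℕ) ∧ consPath x s (n + 1) = x :=
        ⟨by rw [hitTime_consPath_self]; simp, hn⟩
      exact_mod_cast iInf₂_le (f := fun (k : ℕ) (_ : hitTime (consPath x s) x < k ∧
        consPath x s k = x) => (k : ℕ∞)) (n + 1) h1
  · cases n with
    | zero => simp at hn
    | succ n =>
      have : hitTime s x ≤ n := iInf₂_le n hn.2
      push_cast
      gcongr

variable [MeasurableSpace S]

theorem measurable_consPath (x : S) : Measurable (consPath x) := by
  refine measurable_pi_iff.2 fun n => ?_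
  cases n with
  | zero => exact measurable_const
  | succ n => exact measurable_pi_apply n

variable [Countable S] [DiscreteMeasurableSpace S]

theorem measurable_firstTime {T : Type*} [MeasurableSpace T] {p : ℕ → T → Prop}
    (hp : ∀ n, MeasurableSet {s | p n s}) :
    Measurable fun s => ⨅ (n : ℕ) (_ : p n s), (n : ℕ∞) := by
  have hle : ∀ a : ℕ∞, MeasurableSet {s | a ≤ ⨅ (n : ℕ) (_ : p n s), (n : ℕ∞)} := by
    intro a
    simp only [le_iInf_iff, Set.ofPred_forall]
    refine MeasurableSet.iInter fun n => ?_
    by_cases h : a ≤ n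
    · simp [h]
    · simpa [h, Set.compl_ofPred] using (hp n).compl
  refine measurable_to_countable' fun a => ?_
  have : (fun s => ⨅ (n : ℕ) (_ : p n s), (n : ℕ∞)) ⁻¹' {a} =
      {s | a ≤ ⨅ (n : ℕ) (_ : p n s), (n : ℕ∞)} \
        ⋃ c ∈ Set.Ioi a, {s | c ≤ ⨅ (n : ℕ) (_ : p n s), (n : ℕ∞)} := by
    ext s
    simp only [Set.mem_preimage, Set.mem_singleton_iff, Set.mem_sdiff, Set.mem_ofPred_eq,
      Set.mem_iUnion, not_exists, Set.mem_Ioi]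
    refine ⟨fun h => ⟨h.ge, fun c hc hle => absurd (h ▸ hle) (not_le.2 hc)⟩, fun h => ?_⟩
    by_contra hne
    exact h.2 _ (lt_of_le_of_ne h.1 (Ne.symm hne)) le_rfl
  rw [this]
  exact (hle a).diff (MeasurableSet.biUnion (Set.to_countable _) fun c _ => hle c)

theorem measurableSet_lt_enat {T : Type*} [MeasurableSpace T] {f g : T → ℕ∞}
    (hf : Measurable f) (hg : Measurable g) : MeasurableSet {s | f s < g s} :=
  (hf.prodMk hg) (MeasurableSet.of_discrete (s := {p : ℕ∞ × ℕ∞ | p.1 < p.2}))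

theorem measurable_hitTime (z : S) : Measurable fun s : ℕ → S => hitTime s z :=
  measurable_firstTime fun n => measurableSet_eq_fun (measurable_pi_apply n) measurable_const

theorem measurable_secondHitTime (z : S) : Measurable fun s : ℕ → S => secondHitTime s z :=
  measurable_firstTime fun n =>
    (measurableSet_lt_enat (measurable_hitTime z) measurable_const).inter
      (measurableSet_eq_fun (measurable_pi_apply n) measurable_const)

/-- A probability measure on trajectories is determined by the probabilities of the finite
trajectories. -/
theorem trajectory_measure_ext {μ ν : Measure (ℕ → S)} [IsProbabilityMeasure μ]
    [IsProbabilityMeasure ν]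
    (h : ∀ (w : ℕ → S) (n : ℕ), μ {s | ∀ i ≤ n, s i = w i} = ν {s | ∀ i ≤ n, s i = w i}) :
    μ = ν := by
  obtain ⟨s₀⟩ : Nonempty (ℕ → S) := nonempty_of_isProbabilityMeasure μ
  have hmap : ∀ n, μ.map (Preorder.frestrictLe (π := fun _ => S) n) =
      ν.map (Preorder.frestrictLe (π := fun _ => S) n) := by
    intro n
    refine Measure.ext_of_singleton fun f => ?_
    have ew : Preorder.frestrictLe (π := fun _ => S) n ⁻¹' {f} =
        {s | ∀ i ≤ n, s i = if hi : i ≤ n then f ⟨i, Finset.mem_Iic.2 hi⟩ else s₀ 0} := by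
      ext s
      simp only [Set.mem_preimage, Set.mem_singleton_iff, Set.mem_ofPred_eq]
      constructor
      · rintro rfl i hi
        simp [hi]
      · intro hs
        funext i
        have := hs i (Finset.mem_Iic.1 i.2)
        simpa [Finset.mem_Iic.1 i.2] using this
    rw [Measure.map_apply (by fun_prop) (measurableSet_singleton _),
      Measure.map_apply (by fun_prop) (measurableSet_singleton _), ew, h]
  refine ext_of_generate_finite _ (generateFrom_measurableCylinders (α := fun _ : ℕ => S)).symm
    (isPiSystem_measurableCylinders (α := fun _ : ℕ => S)) ?_ (by simp)
  intro A hA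
  obtain ⟨I, B, hB, rfl⟩ := (mem_measurableCylinders (α := fun _ : ℕ => S) _).1 hA
  have hI : I ⊆ Finset.Iic (I.sup id) := fun i hi => Finset.mem_Iic.2 (Finset.le_sup (f := id) hi)
  set n := I.sup id
  set C : Set (Finset.Iic n → S) := (fun h i => h ⟨i.1, hI i.2⟩) ⁻¹' B
  have hC : MeasurableSet C := hB.preimage (by fun_prop)
  have e : cylinder (α := fun _ : ℕ => S) I B =
      Preorder.frestrictLe (π := fun _ => S) n ⁻¹' C := by
    ext s; rfl
  rw [e, ← Measure.map_apply (by fun_prop) hC, hmap, Measure.map_apply (by fun_prop) hC]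

/-- The Markov property at the first step. -/
theorem chainLaw_eq_bind (p : Kernel S S) [IsMarkovKernel p] (x : S) :
    chainLaw p x = (p x).bind fun t => (chainLaw p t).map (consPath x) := by
  have hmeas : Measurable fun t => (chainLaw p t).map (consPath x) := Measurable.of_discrete
  have hprob : IsProbabilityMeasure ((p x).bind fun t => (chainLaw p t).map (consPath x)) := by
    refine ⟨?_⟩
    rw [Measure.bind_apply MeasurableSet.univ hmeas.aemeasurable]
    simp [Measure.map_apply (measurable_consPath x) MeasurableSet.univ]
  refine trajectory_measure_ext fun w n => ?_
  have hms : ∀ (u : ℕ → S) (n : ℕ), MeasurableSet {s : ℕ → S | ∀ i ≤ n, s i = u i} := by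
    intro u n
    simp only [Set.ofPred_forall]
    exact MeasurableSet.iInter fun i => MeasurableSet.iInter fun _ =>
      measurableSet_eq_fun (measurable_pi_apply i) measurable_const
  rw [Measure.bind_apply (hms w n) hmeas.aemeasurable]
  simp only [Measure.map_apply (measurable_consPath x) (hms w n)]
  by_cases hx : x = w 0
  swap
  · have : consPath x ⁻¹' {s | ∀ i ≤ n, s i = w i} = ∅ := by
      ext s
      simp only [Set.mem_preimage, Set.mem_ofPred_eq, Set.mem_empty_iff_false, iff_false]
      exact fun h => hx (h 0 (Nat.zero_le _))
    rw [this, chainLaw_cylinder]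
    simp [hx]
  cases n with
  | zero =>
    have : consPath x ⁻¹' {s | ∀ i ≤ 0, s i = w i} = Set.univ := by
      ext s
      simpa [consPath] using hx
    rw [this, chainLaw_cylinder]
    simp [hx]
  | succ n =>
    have : consPath x ⁻¹' {s | ∀ i ≤ n + 1, s i = w i} = {s | ∀ i ≤ n, s i = w (i + 1)} := by
      ext s
      simp only [Set.mem_preimage, Set.mem_ofPred_eq]
      refine ⟨fun h i hi => h (i + 1) (by omega), fun h i hi => ?_⟩
      cases i with
      | zero => exact hx
      | succ i => exact h i (by omega)
    rw [this]
    simp only [chainLaw_cylinder p _ (fun i => w (i + 1))]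
    rw [lintegral_mul_const _ Measurable.of_discrete, chainLaw_cylinder, Finset.prod_range_succ']
    have h1 : ∀ t : S, Measure.dirac t {w (0 + 1)} =
        Set.indicator {w 1} (fun _ => (1 : ℝ≥0∞)) t := by
      intro t
      rw [Measure.dirac_apply]
      by_cases ht : t = w 1 <;> simp [ht]
    simp only [h1]
    rw [lintegral_indicator (measurableSet_singleton _), setLIntegral_const, one_mul]
    simp [hx, mul_comm]

theorem lintegral_chainLaw (p : Kernel S S) [IsMarkovKernel p] (x : S) {F : (ℕ → S) → ℝ≥0∞}
    (hF : Measurable F) :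
    ∫⁻ s, F s ∂chainLaw p x = ∫⁻ t, ∫⁻ s, F (consPath x s) ∂chainLaw p t ∂p x := by
  rw [chainLaw_eq_bind, Measure.lintegral_bind (Measurable.of_discrete).aemeasurable
    hF.aemeasurable]
  simp only [lintegral_map hF (measurable_consPath x)]

theorem chainLaw_apply (p : Kernel S S) [IsMarkovKernel p] (x : S) {A : Set (ℕ → S)}
    (hA : MeasurableSet A) :
    chainLaw p x A = ∫⁻ t, chainLaw p t (consPath x ⁻¹' A) ∂p x := by
  rw [chainLaw_eq_bind, Measure.bind_apply hA (Measurable.of_discrete).aemeasurable]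
  simp only [Measure.map_apply (measurable_consPath x) hA]

end FirstStep

/-! ### The killed walk -/

/-- The weight of a step, in either direction, out of the site `z` of the potential `v`. -/
def stepWeight (v : ℤ → ℝ≥0∞) (z : ℤ) : ℝ := (expNeg (v z)).toReal / 2

theorem stepWeight_nonneg (v : ℤ → ℝ≥0∞) (z : ℤ) : 0 ≤ stepWeight v z := by
  unfold stepWeight; positivity

theorem stepWeight_le (v : ℤ → ℝ≥0∞) (z : ℤ) : stepWeight v z ≤ 1 / 2 := by
  have : (expNeg (v z)).toReal ≤ 1 := ENNReal.toReal_le_of_le_ofReal zero_le_one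
    (by simpa using expNeg_le_one (v z))
  unfold stepWeight
  linarith

theorem expNeg_ne_top (v : ℝ≥0∞) : expNeg v ≠ ⊤ :=
  ((expNeg_le_one v).trans_lt ENNReal.one_lt_top).ne

theorem expNeg_mul_inv_two (v : ℤ → ℝ≥0∞) (z : ℤ) :
    expNeg (v z) * 2⁻¹ = ENNReal.ofReal (stepWeight v z) := by
  rw [stepWeight, div_eq_mul_inv, ENNReal.ofReal_mul ENNReal.toReal_nonneg,
    ENNReal.ofReal_toReal (expNeg_ne_top _), ENNReal.ofReal_inv_of_pos two_pos]
  simp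

theorem expNeg_add (a b : ℝ≥0∞) : expNeg (a + b) = expNeg a * expNeg b := by
  unfold expNeg
  rw [EReal.coe_ennreal_add, EReal.neg_add (by simp) (by simp), sub_eq_add_neg, EReal.exp_add]

theorem expNeg_zero : expNeg 0 = 1 := by
  simp [expNeg]

theorem lintegral_killedKernel (v : ℤ → ℝ≥0∞) (z : ℤ) (F : Option ℤ → ℝ≥0∞) (hF : F none = 0) :
    ∫⁻ t, F t ∂killedKernel v (some z) =
      ENNReal.ofReal (stepWeight v z) * (F (some (z - 1)) + F (some (z + 1))) := by
  have : killedKernel v (some z) = killedStep v (some z) := rfl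
  rw [this, killedStep, lintegral_add_measure, lintegral_smul_measure, lintegral_smul_measure,
    lintegral_add_measure, lintegral_smul_measure, lintegral_smul_measure, lintegral_dirac,
    lintegral_dirac, lintegral_dirac, hF, ← expNeg_mul_inv_two]
  simp only [smul_eq_mul]
  ring

theorem chainLaw_killed_none (v : ℤ → ℝ≥0∞) (y : ℤ) (A : Set (ℕ → Option ℤ))
    (hA : ∀ s ∈ A, ∃ n, s n = some y) : chainLaw (killedKernel v) none A = 0 := by
  have h1 : ∀ n, ∀ᵐ s ∂chainLaw (killedKernel v) none, ∀ i ≤ n, s i = none := by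
    intro n
    have hms : MeasurableSet {s : ℕ → Option ℤ | ∀ i ≤ n, s i = none} := by
      simp only [Set.ofPred_forall]
      exact MeasurableSet.iInter fun i => MeasurableSet.iInter fun _ =>
        measurableSet_eq_fun (measurable_pi_apply i) measurable_const
    refine (prob_compl_eq_zero_iff hms).2 ?_
    rw [chainLaw_cylinder _ _ fun _ => none]
    have : killedKernel v none {none} = 1 := by
      have h : killedKernel v none = Measure.dirac none := rfl
      simp [h]
    simp [this]
  rw [← ae_all_iff] at h1
  refine measure_mono_null (fun s hs => ?_) h1
  obtain ⟨n, hn⟩ := hA s hs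
  simp only [Set.mem_compl_iff, Set.mem_ofPred_eq, not_forall]
  exact ⟨n, n, le_rfl, by simp [hn]⟩

/-- The weight of bridges is the probability that the killed walk hits `n + 1` before it returns
to its start. -/
theorem chainLaw_killed_bridge (v : ℤ → ℝ≥0∞) (n : ℕ) :
    chainLaw (killedKernel v) (some 0) {s | hitTime s (some ((n + 1 : ℕ) : ℤ)) <
      secondHitTime s (some 0) ∧ hitTime s (some ((n + 1 : ℕ) : ℤ)) < ⊤} =
      ENNReal.ofReal (bridge (stepWeight v) 0 (n + 1)) := by
  set y : ℤ := ((n + 1 : ℕ) : ℤ) with hy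
  have hy0 : (0 : ℤ) < y := by positivity
  set A : Set (ℕ → Option ℤ) := {s | hitTime s (some y) < hitTime s (some 0)}
  have hA : MeasurableSet A := measurableSet_lt_enat (measurable_hitTime _) (measurable_hitTime _)
  -- After the first step from `0` the second visit to `0` becomes a first visit, so the event to be
  -- computed reduces to `A`; strictness in `A` already forces a finite hitting time.
  have hnone : chainLaw (killedKernel v) none A = 0 := by
    refine chainLaw_killed_none v y A fun s hs => ?_
    obtain ⟨m, hm, -⟩ := exists_hitTime_eq (lt_top_of_lt hs).ne
    exact ⟨m, hm⟩
  set H : ℤ → ℝ≥0∞ := fun z => chainLaw (killedKernel v) (some z) A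
  have hH1 : ∀ z, H z ≠ ⊤ := fun z => measure_ne_top _ _
  have hpre : ∀ z, z ≠ 0 → z ≠ y → consPath (some z) ⁻¹' A = A := by
    intro z h0 h1
    ext s
    simp only [A, Set.mem_preimage, Set.mem_ofPred_eq]
    rw [hitTime_consPath_of_ne (by simpa using h1), hitTime_consPath_of_ne (by simpa using h0)]
    simp
  have hstep : ∀ z, z ≠ 0 → z ≠ y →
      H z = ENNReal.ofReal (stepWeight v z) * (H (z - 1) + H (z + 1)) := by
    intro z h0 h1
    simp only [H]
    rw [chainLaw_apply _ _ hA, hpre z h0 h1, lintegral_killedKernel _ _ _ hnone]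
  have hHy : H y = 1 := by
    have : consPath (some y) ⁻¹' A = Set.univ := by
      ext s
      simp only [A, Set.mem_preimage, Set.mem_ofPred_eq, Set.mem_univ, iff_true]
      rw [hitTime_consPath_self, hitTime_consPath_of_ne (by simpa using hy0.ne')]
      simp
    simp only [H]
    rw [chainLaw_apply _ _ hA, this]
    simp
  have hH0 : H 0 = 0 := by
    have : consPath (some 0) ⁻¹' A = ∅ := by
      ext s
      simp only [A, Set.mem_preimage, Set.mem_ofPred_eq, Set.mem_empty_iff_false, iff_false]
      rw [hitTime_consPath_self]
      simp
    simp only [H]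
    rw [chainLaw_apply _ _ hA, this]
    simp
  have hE : MeasurableSet {s : ℕ → Option ℤ | hitTime s (some y) <
      secondHitTime s (some 0) ∧ hitTime s (some y) < ⊤} :=
    (measurableSet_lt_enat (measurable_hitTime _) (measurable_secondHitTime _)).inter
      (measurableSet_lt_enat (measurable_hitTime _) measurable_const)
  have hpre0 : consPath (some (0 : ℤ)) ⁻¹' {s | hitTime s (some y) <
      secondHitTime s (some 0) ∧ hitTime s (some y) < ⊤} = A := by
    ext s
    simp only [A, Set.mem_preimage, Set.mem_ofPred_eq]
    rw [hitTime_consPath_of_ne (by simpa using hy0.ne), secondHitTime_consPath_self]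
    constructor
    · rintro ⟨h, -⟩
      simpa using h
    · intro h
      refine ⟨by simpa using h, ?_⟩
      exact ENat.add_lt_top.2 ⟨lt_top_of_lt h, by simp⟩
  rw [chainLaw_apply _ _ hE, hpre0, lintegral_killedKernel _ _ _ hnone]
  have hfinal := bridge_eq_of_harmonic (h := fun z => (H z).toReal) (stepWeight_nonneg v)
    (stepWeight_le v) n (by simp [hH0]) (by rw [← hy]; simp [hHy]) (by
      intro z h0 h1
      rw [hstep z h0.ne' h1.ne, ENNReal.toReal_mul, ENNReal.toReal_add (hH1 _) (hH1 _),
        ENNReal.toReal_ofReal (stepWeight_nonneg v z)])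
  -- A first step to the left contributes nothing: the hitting probability is nondecreasing to the
  -- left of `0` and vanishes at `0`.
  have hm1 : chainLaw (killedKernel v) (some (0 - 1)) A = 0 := by
    have h := harmonic_le_succ (Z := fun z => (H z).toReal) (y := 0) (z := 0 - 1)
      (stepWeight_le v) (fun z => ENNReal.toReal_nonneg)
      (fun z => ENNReal.toReal_le_of_le_ofReal zero_le_one (by simpa using prob_le_one)) (by
        intro z hz
        rw [hstep z hz.ne (by omega), ENNReal.toReal_mul, ENNReal.toReal_add (hH1 _) (hH1 _),
          ENNReal.toReal_ofReal (stepWeight_nonneg v z)]) (by norm_num)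
    have h2 : (H (0 - 1)).toReal = 0 :=
      le_antisymm (by simpa [hH0] using h) ENNReal.toReal_nonneg
    exact ((ENNReal.toReal_eq_zero_iff _).1 h2).resolve_right (hH1 _)
  rw [hm1, zero_add, ← hfinal, ENNReal.ofReal_mul (stepWeight_nonneg v 0),
    ENNReal.ofReal_toReal (hH1 _)]
  rfl

/-! ### The weighted simple random walk -/

/-- The quenched partition function of the paths from `x` to `y`. -/
def partition (v : ℤ → ℝ≥0∞) (y x : ℤ) : ℝ≥0∞ :=
  ∫⁻ s, weight (fun z (v : ℤ → ℝ≥0∞) => v z) y (v, s) ∂srw x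

variable {Ω : Type*}

theorem measurable_weight [MeasurableSpace Ω] {V : ℤ → Ω → ℝ≥0∞}
    (hV : ∀ z, Measurable (V z)) (y : ℤ) :
    Measurable (weight V y) := by
  have h1 : Measurable fun q : Ω × (ℕ → ℤ) => hitTime q.2 y :=
    (measurable_hitTime y).comp measurable_snd
  have h2 : ∀ n, Measurable fun q : Ω × (ℕ → ℤ) => V (q.2 n) q.1 := by
    intro n
    have h3 : Measurable fun r : ℤ × Ω => V r.1 r.2 :=
      measurable_from_prod_countable_right hV
    have h5 : Measurable fun q : Ω × (ℕ → ℤ) => (q.2 n, q.1) := by fun_prop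
    exact h3.comp h5
  have h4 : Measurable fun r : (Ω × (ℕ → ℤ)) × ℕ∞ =>
      expNeg (∑ n ∈ Finset.range r.2.toNat, V (r.1.2 n) r.1.1) :=
    measurable_from_prod_countable_left fun k =>
      measurable_expNeg.comp (Finset.measurable_sum (Finset.range k.toNat) fun n _ => h2 n)
  have h6 : Measurable fun q : Ω × (ℕ → ℤ) =>
      expNeg (∑ n ∈ Finset.range (hitTime q.2 y).toNat, V (q.2 n) q.1) :=
    h4.comp (g := fun r : (Ω × (ℕ → ℤ)) × ℕ∞ =>
      expNeg (∑ n ∈ Finset.range r.2.toNat, V (r.1.2 n) r.1.1)) (f := fun q => (q, hitTime q.2 y))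
      (measurable_id.prodMk h1)
  have h7 : MeasurableSet {q : Ω × (ℕ → ℤ) | hitTime q.2 y < ⊤} :=
    measurableSet_lt_enat h1 measurable_const
  unfold weight
  exact Measurable.ite h7 h6 measurable_const

theorem weight_le_one (V : ℤ → Ω → ℝ≥0∞) (y : ℤ) (q : Ω × (ℕ → ℤ)) : weight V y q ≤ 1 := by
  unfold weight
  split_ifs
  · exact expNeg_le_one _
  · exact zero_le

theorem weight_consPath_self (V : ℤ → Ω → ℝ≥0∞) (y : ℤ) (ω : Ω) (s : ℕ → ℤ) :
    weight V y (ω, consPath y s) = 1 := by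
  simp [weight, hitTime_consPath_self, expNeg_zero]

theorem weight_consPath_of_ne (V : ℤ → Ω → ℝ≥0∞) {x y : ℤ} (h : x ≠ y) (ω : Ω) (s : ℕ → ℤ) :
    weight V y (ω, consPath x s) = expNeg (V x ω) * weight V y (ω, s) := by
  unfold weight
  simp only [hitTime_consPath_of_ne h]
  by_cases ht : hitTime s y = ⊤
  · simp [ht]
  · obtain ⟨n, -, hn⟩ := exists_hitTime_eq ht
    have h1 : ((n : ℕ∞) + 1) = ((n + 1 : ℕ) : ℕ∞) := by push_cast; rfl
    rw [hn, h1]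
    simp only [ENat.natCast_lt_top, if_true, ENat.toNat_natCast]
    rw [Finset.sum_range_succ', add_comm, expNeg_add]
    rfl

theorem partition_le_one (v : ℤ → ℝ≥0∞) (y x : ℤ) : partition v y x ≤ 1 := by
  have : IsProbabilityMeasure (srw x) := by unfold srw; infer_instance
  calc partition v y x ≤ ∫⁻ _, 1 ∂srw x := lintegral_mono fun s => weight_le_one _ _ _
    _ = 1 := by simp

theorem measurable_weight_path (v : ℤ → ℝ≥0∞) (y : ℤ) :
    Measurable fun s => weight (fun z (v : ℤ → ℝ≥0∞) => v z) y (v, s) :=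
  (measurable_weight (fun z => measurable_pi_apply z) y).comp measurable_prodMk_left

theorem partition_self (v : ℤ → ℝ≥0∞) (y : ℤ) : partition v y y = 1 := by
  rw [partition, srw, lintegral_chainLaw _ _ (measurable_weight_path v y)]
  simp [weight_consPath_self]

theorem partition_step (v : ℤ → ℝ≥0∞) {x y : ℤ} (h : x ≠ y) :
    partition v y x =
      ENNReal.ofReal (stepWeight v x) * (partition v y (x - 1) + partition v y (x + 1)) := by
  rw [partition, srw, lintegral_chainLaw _ _ (measurable_weight_path v y)]
  simp only [weight_consPath_of_ne _ h, lintegral_const_mul _ (measurable_weight_path v y)]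
  have : srwKernel x =
    (2⁻¹ : ℝ≥0∞) • Measure.dirac (x + 1) + (2⁻¹ : ℝ≥0∞) • Measure.dirac (x - 1) := rfl
  rw [this, lintegral_add_measure, lintegral_smul_measure, lintegral_smul_measure,
    lintegral_dirac, lintegral_dirac, ← expNeg_mul_inv_two]
  simp only [smul_eq_mul, partition, srw]
  ring

/-- The weight of the bridges, as an extended nonnegative number. -/
def bridgeWeight (v : ℤ → ℝ≥0∞) (x : ℤ) (n : ℕ) : ℝ≥0∞ :=
  ENNReal.ofReal (bridge (stepWeight v) x n)

theorem partition_toReal_step (v : ℤ → ℝ≥0∞) {x y : ℤ} (h : x ≠ y) :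
    (partition v y x).toReal =
      stepWeight v x * ((partition v y (x - 1)).toReal + (partition v y (x + 1)).toReal) := by
  have hf : ∀ z, partition v y z ≠ ⊤ := fun z =>
    ((partition_le_one v y z).trans_lt ENNReal.one_lt_top).ne
  rw [partition_step v h, ENNReal.toReal_mul, ENNReal.toReal_add (hf _) (hf _),
    ENNReal.toReal_ofReal (stepWeight_nonneg v x)]

theorem bridgeWeight_le_partition (v : ℤ → ℝ≥0∞) (n : ℕ) :
    bridgeWeight v 0 n ≤ partition v n 0 := by
  refine ENNReal.ofReal_le_of_le_toReal ?_
  exact bridge_le_of_harmonic (Z := fun z => (partition v n z).toReal) (stepWeight_nonneg v)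
    (stepWeight_le v) (fun z => ENNReal.toReal_nonneg) (by simp [partition_self])
    fun z hz => partition_toReal_step v hz.ne

theorem partition_le_bridgeWeight (v : ℤ → ℝ≥0∞) (n k : ℕ) {g : ℝ} (hg : 0 < g)
    (hk : 1 ≤ g * (1 - 2 * stepWeight v (-(k + 1 : ℕ)))) :
    partition v (n + 1 : ℕ) 0 ≤ ENNReal.ofReal (2 * (g + k)) * bridgeWeight v 0 (n + 1) := by
  have hf : partition v (n + 1 : ℕ) 0 ≠ ⊤ :=
    ((partition_le_one v _ 0).trans_lt ENNReal.one_lt_top).ne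
  rw [bridgeWeight, ← ENNReal.ofReal_mul (by positivity), ← ENNReal.ofReal_toReal hf]
  refine ENNReal.ofReal_le_ofReal ?_
  exact harmonic_le_bridge (Z := fun z => (partition v (n + 1 : ℕ) z).toReal)
    (stepWeight_nonneg v) (stepWeight_le v) hg (fun z => ENNReal.toReal_nonneg)
    (fun z => ENNReal.toReal_le_of_le_ofReal zero_le_one (by simpa using partition_le_one v _ z))
    (by simp [partition_self]) (fun z hz => partition_toReal_step v hz.ne) hk

/-! ### Stationary independent environments -/

/-- The law `ν` of an environment makes the potentials of the sites independent, and is invariant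
under translations. -/
structure IsIIDEnvironment (ν : Measure (ℤ → ℝ≥0∞)) : Prop where
  indep : iIndepFun (fun (z : ℤ) (v : ℤ → ℝ≥0∞) => v z) ν
  shift : ∀ x : ℤ, MeasurePreserving (fun (v : ℤ → ℝ≥0∞) z => v (x + z)) ν ν

/-- The law of an i.i.d. family is the infinite product of its common marginal, and the shifted
family has the same product as its law. -/
theorem isIIDEnvironment_map {Ω : Type*} [MeasurableSpace Ω] {P : Measure Ω}
    [IsProbabilityMeasure P] {V : ℤ → Ω → ℝ≥0∞} (hV : ∀ z, Measurable (V z))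
    (hindep : iIndepFun V P) (hident : ∀ z, IdentDistrib (V z) (V 0) P P) :
    IsIIDEnvironment (P.map fun ω z => V z ω) := by
  have hm : Measurable fun ω z => V z ω := measurable_pi_iff.2 hV
  constructor
  · have h := (iIndepFun_iff_map_fun_eq_infinitePi_map hV).1 hindep
    have : IsProbabilityMeasure (P.map fun ω z => V z ω) :=
      Measure.isProbabilityMeasure_map hm.aemeasurable
    rw [iIndepFun_iff_map_fun_eq_infinitePi_map fun z => measurable_pi_apply z]
    have e : ∀ z : ℤ, (P.map fun ω z => V z ω).map (fun v : ℤ → ℝ≥0∞ => v z) = P.map (V z) :=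
      fun z => Measure.map_map (measurable_pi_apply z) hm
    simp only [e, ← h]
    exact Measure.map_id
  · intro x
    have hm' : Measurable fun (v : ℤ → ℝ≥0∞) z => v (x + z) :=
      measurable_pi_iff.2 fun z => measurable_pi_apply _
    refine ⟨hm', ?_⟩
    rw [Measure.map_map hm' hm]
    have h1 := (iIndepFun_iff_map_fun_eq_infinitePi_map hV).1 hindep
    have h2 := (iIndepFun_iff_map_fun_eq_infinitePi_map (fun z => hV (x + z))).1
      (hindep.precomp (add_right_injective x))
    have e : ∀ z, P.map (V z) = P.map (V 0) := fun z => (hident z).map_eq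
    simp only [e] at h1 h2
    rw [h1, ← h2]
    rfl

theorem IsIIDEnvironment.lintegral_mul {ν : Measure (ℤ → ℝ≥0∞)} (hν : IsIIDEnvironment ν)
    {F G : (ℤ → ℝ≥0∞) → ℝ≥0∞} (hF : Measurable F) (hG : Measurable G) (S T : Finset ℤ)
    (hST : Disjoint S T) (hFS : DependsOn F S) (hGT : DependsOn G T) :
    ∫⁻ v, F v * G v ∂ν = (∫⁻ v, F v ∂ν) * ∫⁻ v, G v ∂ν := by
  classical
  have key : ∀ (S : Finset ℤ) (F : (ℤ → ℝ≥0∞) → ℝ≥0∞), Measurable F → DependsOn F S →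
      ∃ F' : (S → ℝ≥0∞) → ℝ≥0∞, Measurable F' ∧ F = F' ∘ fun v (i : S) => v i := by
    intro S F hF hFS
    -- The value `0` off `S` is arbitrary, as `F` does not see those sites.
    refine ⟨fun w => F fun z => if h : z ∈ S then w ⟨z, h⟩ else 0, ?_, ?_⟩
    · refine hF.comp (measurable_pi_iff.2 fun z => ?_)
      by_cases h : z ∈ S
      · simpa [h] using measurable_pi_apply _
      · simp [h]
    · funext v
      refine hFS fun z hz => ?_
      simp [Finset.mem_coe.1 hz]
  obtain ⟨F', hF', eF⟩ := key S F hF hFS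
  obtain ⟨G', hG', eG⟩ := key T G hG hGT
  have hi := hν.indep.indepFun_finset S T hST fun z => measurable_pi_apply z
  have hFG := hi.comp hF' hG'
  rw [← eF, ← eG] at hFG
  exact lintegral_mul_eq_lintegral_mul_lintegral_of_indepFun hF hG hFG

/-! ### Locality of the weights -/

theorem crossRatio_congr {e e' : ℤ → ℝ} (t : ℝ) (x : ℤ) (k : ℕ)
    (h : ∀ z, x < z → z ≤ x + k → e z = e' z) : crossRatio e t x k = crossRatio e' t x k := by
  induction k with
  | zero => rfl
  | succ k ih =>
    rw [crossRatio, crossRatio, ih fun z h1 h2 => h z h1 (by push_cast; linarith),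
      h (x + k + 1) (by linarith) (by push_cast; linarith)]

/-- The window is half-open: the potential at the end point is not paid. Consecutive bridges
therefore use disjoint sets of sites and are independent. -/
theorem bridge_congr {e e' : ℤ → ℝ} (x : ℤ) (n : ℕ)
    (h : ∀ z, x ≤ z → z < x + n → e z = e' z) : bridge e x n = bridge e' x n := by
  refine Finset.prod_congr rfl fun k hk => ?_
  have hk' := Finset.mem_range.1 hk
  cases k with
  | zero => exact h x le_rfl (by omega)
  | succ k =>
    exact crossRatio_congr 0 x (k + 1) fun z h1 h2 => h z h1.le (by push_cast at h2 ⊢; omega)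

theorem crossRatio_shift (e : ℤ → ℝ) (t : ℝ) (c x : ℤ) (k : ℕ) :
    crossRatio (fun z => e (c + z)) t x k = crossRatio e t (c + x) k := by
  induction k with
  | zero => rfl
  | succ k ih => rw [crossRatio, crossRatio, ih]; simp only [add_assoc]

theorem bridge_shift (e : ℤ → ℝ) (c x : ℤ) (n : ℕ) :
    bridge (fun z => e (c + z)) x n = bridge e (c + x) n := by
  refine Finset.prod_congr rfl fun k _ => ?_
  cases k with
  | zero => rfl
  | succ k => exact crossRatio_shift e 0 c x (k + 1)

/-! ### Measurability and splitting inequalities for `bridgeWeight` -/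

theorem measurable_stepWeight (z : ℤ) : Measurable fun v => stepWeight v z := by
  unfold stepWeight
  have : Measurable fun v : ℤ → ℝ≥0∞ => expNeg (v z) :=
    measurable_expNeg.comp (measurable_pi_apply z)
  fun_prop

theorem measurable_crossRatio (t : ℝ) (x : ℤ) (k : ℕ) :
    Measurable fun v => crossRatio (stepWeight v) t x k := by
  induction k with
  | zero => exact measurable_const
  | succ k ih =>
    simp only [crossRatio]
    have := measurable_stepWeight (x + k + 1)
    fun_prop

theorem measurable_bridgeWeight (x : ℤ) (n : ℕ) : Measurable fun v => bridgeWeight v x n := by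
  refine ENNReal.measurable_ofReal.comp (Finset.measurable_prod _ fun k _ => ?_)
  cases k with
  | zero => exact measurable_stepWeight x
  | succ k => exact measurable_crossRatio 0 x (k + 1)

theorem bridgeWeight_mul_le (v : ℤ → ℝ≥0∞) (x : ℤ) (a b : ℕ) :
    bridgeWeight v x a * bridgeWeight v (x + a) b ≤ bridgeWeight v x (a + b) := by
  unfold bridgeWeight
  rw [← ENNReal.ofReal_mul (bridge_nonneg (stepWeight_nonneg v) (stepWeight_le v) _ _)]
  exact ENNReal.ofReal_le_ofReal (bridge_mul_le (stepWeight_nonneg v) (stepWeight_le v) x a b)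

theorem bridgeWeight_add_le (v : ℤ → ℝ≥0∞) (x : ℤ) {a b : ℕ} (ha : 1 ≤ a) (hb : 1 ≤ b) :
    bridgeWeight v x (a + b) ≤ 2 * a * (bridgeWeight v x a * bridgeWeight v (x + a) b) := by
  have h := ENNReal.ofReal_le_ofReal
    (bridge_add_le (stepWeight_nonneg v) (stepWeight_le v) x ha hb)
  rw [ENNReal.ofReal_mul (by positivity), ENNReal.ofReal_mul
    (bridge_nonneg (stepWeight_nonneg v) (stepWeight_le v) _ _), ENNReal.ofReal_mul (by norm_num),
    ENNReal.ofReal_natCast, ENNReal.ofReal_ofNat] at h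
  exact h

theorem bridgeWeight_add_le_of_killing (v : ℤ → ℝ≥0∞) (x : ℤ) {a b : ℕ} {g : ℝ≥0} (ha : 1 ≤ a)
    (hb : 1 ≤ b) (hx : 1 ≤ (g : ℝ) * (1 - 2 * stepWeight v (x + a))) :
    bridgeWeight v x (a + b) ≤ g * (bridgeWeight v x a * bridgeWeight v (x + a) b) := by
  have h := ENNReal.ofReal_le_ofReal
    (bridge_add_le_of_killing (stepWeight_nonneg v) (stepWeight_le v) x g.coe_nonneg ha hb hx)
  rw [ENNReal.ofReal_mul g.coe_nonneg, ENNReal.ofReal_mul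
    (bridge_nonneg (stepWeight_nonneg v) (stepWeight_le v) _ _), ENNReal.ofReal_coe_nnreal] at h
  exact h

theorem bridgeWeight_le_one (v : ℤ → ℝ≥0∞) (x : ℤ) (n : ℕ) : bridgeWeight v x n ≤ 1 :=
  ENNReal.ofReal_le_one.2 (bridge_le_one (stepWeight_nonneg v) (stepWeight_le v) x n)

/-! ### Bridges in environments with prescribed reasonable sites -/

/-- The environments in which the reasonable sites of `I` are those of `X`. -/
abbrev envPattern (κ K : ℝ≥0) (I X : Set ℤ) : Set (ℤ → ℝ≥0∞) :=
  reasonableExactly (fun z v => v z) κ K I X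

theorem measurableSet_reasonableExactly {Ω : Type*} [MeasurableSpace Ω] {V : ℤ → Ω → ℝ≥0∞}
    (hV : ∀ z, Measurable (V z)) (κ K : ℝ≥0) (I X : Set ℤ) :
    MeasurableSet (reasonableExactly V κ K I X) := by
  have h : ∀ z, MeasurableSet {ω | V z ω ∈ Set.Icc (κ : ℝ≥0∞) K} := fun z =>
    hV z measurableSet_Icc
  unfold reasonableExactly
  simp only [Set.ofPred_and, Set.ofPred_forall]
  exact (MeasurableSet.iInter fun z => MeasurableSet.iInter fun _ => h z).inter
    (MeasurableSet.iInter fun z => MeasurableSet.iInter fun _ => (h z).compl)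

theorem measurableSet_envPattern (κ K : ℝ≥0) (I X : Set ℤ) :
    MeasurableSet (envPattern κ K I X) :=
  measurableSet_reasonableExactly (fun z => measurable_pi_apply z) κ K I X

/-- The weight of the bridges from `x` to `x + n`, on the event that the reasonable sites of `I`
are those of `X`. -/
def patternBridge (κ K : ℝ≥0) (I X : Set ℤ) (x : ℤ) (n : ℕ) : (ℤ → ℝ≥0∞) → ℝ≥0∞ :=
  (envPattern κ K I X).indicator fun v => bridgeWeight v x n

theorem measurable_patternBridge (κ K : ℝ≥0) (I X : Set ℤ) (x : ℤ) (n : ℕ) :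
    Measurable (patternBridge κ K I X x n) :=
  (measurable_bridgeWeight x n).indicator (measurableSet_envPattern κ K I X)

theorem measurable_patternBridge_mul (κ K : ℝ≥0) (I X I' X' : Set ℤ) (x x' : ℤ) (n n' : ℕ) :
    Measurable fun v => patternBridge κ K I X x n v * patternBridge κ K I' X' x' n' v :=
  (measurable_patternBridge ..).mul (measurable_patternBridge ..)

theorem patternBridge_le (κ K : ℝ≥0) (I X : Set ℤ) (x : ℤ) (n : ℕ) (v : ℤ → ℝ≥0∞) :
    patternBridge κ K I X x n v ≤ bridgeWeight v x n :=
  Set.indicator_le_self _ _ v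

theorem dependsOn_bridgeWeight (x : ℤ) (n : ℕ) :
    DependsOn (fun v => bridgeWeight v x n) (Finset.Ico x (x + n) : Finset ℤ) := by
  intro v w h
  refine congrArg ENNReal.ofReal (bridge_congr x n fun z h1 h2 => ?_)
  rw [stepWeight, stepWeight, h z (by simp [h1, h2])]

theorem dependsOn_patternBridge (κ K : ℝ≥0) {I X : Set ℤ} {x : ℤ} {n : ℕ}
    (hI : I ⊆ Set.Ico x (x + n)) (hX : X ⊆ Set.Ico x (x + n)) :
    DependsOn (patternBridge κ K I X x n) (Finset.Ico x (x + n) : Finset ℤ) := by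
  intro v w h
  have h' : ∀ z ∈ Set.Ico x (x + n), v z = w z := fun z hz => h z (by simpa using hz)
  have hmem : v ∈ envPattern κ K I X ↔ w ∈ envPattern κ K I X := by
    refine and_congr (forall₂_congr fun z hz => ?_) (forall₂_congr fun z hz => ?_)
    · simp only [h' z (hX hz)]
    · simp only [h' z (hI hz.1)]
  have hb := dependsOn_bridgeWeight x n h
  unfold patternBridge
  by_cases hv : v ∈ envPattern κ K I X
  · rw [Set.indicator_of_mem hv, Set.indicator_of_mem (hmem.1 hv)]
    exact hb
  · rw [Set.indicator_of_notMem hv, Set.indicator_of_notMem (mt hmem.2 hv)]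

theorem disjoint_Ico_int (x : ℤ) (a b : ℕ) :
    Disjoint (Finset.Ico x (x + a)) (Finset.Ico (x + a) (x + a + b)) := by
  refine Finset.disjoint_left.2 fun z h1 h2 => ?_
  simp only [Finset.mem_Ico] at h1 h2
  omega

/-! ### Annealed bridge weights -/

section Averages

variable {ν : Measure (ℤ → ℝ≥0∞)}

/-- The annealed weight of the bridges over a distance `n`. -/
def meanBridge (ν : Measure (ℤ → ℝ≥0∞)) (n : ℕ) : ℝ≥0∞ := ∫⁻ v, bridgeWeight v 0 n ∂ν

/-- The annealed weight of the bridges over a distance `n` whose first `L` sites, other than the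
starting point, are not reasonable. -/
def gapBridge (ν : Measure (ℤ → ℝ≥0∞)) (κ K : ℝ≥0) (L n : ℕ) : ℝ≥0∞ :=
  ∫⁻ v, patternBridge κ K (Set.Ioo 0 L) ∅ 0 n v ∂ν

theorem lintegral_bridgeWeight (hν : IsIIDEnvironment ν) (x : ℤ) (n : ℕ) :
    ∫⁻ v, bridgeWeight v x n ∂ν = meanBridge ν n := by
  rw [meanBridge, ← (hν.shift x).lintegral_comp (measurable_bridgeWeight 0 n)]
  refine lintegral_congr fun v => congrArg ENNReal.ofReal ?_
  have := bridge_shift (stepWeight v) x 0 n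
  rw [add_zero] at this
  exact this.symm

theorem lintegral_patternBridge_empty (hν : IsIIDEnvironment ν) (κ K : ℝ≥0) (x : ℤ) (L n : ℕ) :
    ∫⁻ v, patternBridge κ K (Set.Ioo x (x + L)) ∅ x n v ∂ν = gapBridge ν κ K L n := by
  rw [gapBridge, ← (hν.shift x).lintegral_comp (measurable_patternBridge κ K (Set.Ioo 0 L) ∅ 0 n)]
  refine lintegral_congr fun v => ?_
  have hb : bridgeWeight (fun z => v (x + z)) 0 n = bridgeWeight v x n := by
    refine congrArg ENNReal.ofReal ?_
    have := bridge_shift (stepWeight v) x 0 n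
    rw [add_zero] at this
    exact this
  have hmem : (fun z => v (x + z)) ∈ envPattern κ K (Set.Ioo 0 L) ∅ ↔
      v ∈ envPattern κ K (Set.Ioo x (x + L)) ∅ := by
    simp only [reasonableExactly, Set.mem_ofPred_eq, Set.mem_empty_iff_false, false_imp_iff,
      forall_const, true_and, Set.sdiff_empty, Set.mem_Ioo]
    constructor
    · intro h z hz
      have := h (z - x) ⟨by omega, by omega⟩
      rwa [add_sub_cancel] at this
    · exact fun h z hz => h (x + z) ⟨by omega, by omega⟩
  unfold patternBridge
  by_cases hv : v ∈ envPattern κ K (Set.Ioo x (x + L)) ∅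
  · rw [Set.indicator_of_mem hv, Set.indicator_of_mem (hmem.2 hv), hb]
  · rw [Set.indicator_of_notMem hv, Set.indicator_of_notMem (mt hmem.1 hv)]

/-- Supermultiplicativity survives averaging, because the two bridges live on disjoint windows. -/
theorem meanBridge_mul_le (hν : IsIIDEnvironment ν) (a b : ℕ) :
    meanBridge ν a * meanBridge ν b ≤ meanBridge ν (a + b) := by
  rw [← lintegral_bridgeWeight hν 0 a, ← lintegral_bridgeWeight hν (0 + a) b,
    ← hν.lintegral_mul (measurable_bridgeWeight _ _) (measurable_bridgeWeight _ _) _ _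
      (disjoint_Ico_int 0 a b) (dependsOn_bridgeWeight _ _) (dependsOn_bridgeWeight _ _)]
  exact lintegral_mono fun v => bridgeWeight_mul_le v 0 a b

theorem gapBridge_le_meanBridge (κ K : ℝ≥0) (L n : ℕ) :
    gapBridge ν κ K L n ≤ meanBridge ν n :=
  lintegral_mono fun v => patternBridge_le _ _ _ _ _ _ v

theorem meanBridge_le_one [IsProbabilityMeasure ν] (n : ℕ) : meanBridge ν n ≤ 1 := by
  calc meanBridge ν n ≤ ∫⁻ _, 1 ∂ν := lintegral_mono fun v => bridgeWeight_le_one v 0 n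
    _ = 1 := by simp

/-- A gap splits at any of its sites. -/
theorem gapBridge_add_le (hν : IsIIDEnvironment ν) (κ K : ℝ≥0) {l L n : ℕ} (hl : 1 ≤ l)
    (hn : 1 ≤ n) (hL : L ≤ n) :
    gapBridge ν κ K (l + L) (l + n) ≤
      2 * l * (gapBridge ν κ K l l * gapBridge ν κ K L n) := by
  have hpt : ∀ v, patternBridge κ K (Set.Ioo 0 ((l + L : ℕ) : ℤ)) ∅ 0 (l + n) v ≤
      2 * l * (patternBridge κ K (Set.Ioo 0 (0 + l)) ∅ 0 l v *
        patternBridge κ K (Set.Ioo (0 + l) (0 + l + L)) ∅ (0 + l) n v) := by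
    intro v
    by_cases hv : v ∈ envPattern κ K (Set.Ioo 0 ((l + L : ℕ) : ℤ)) ∅
    swap
    · rw [patternBridge, Set.indicator_of_notMem hv]
      exact zero_le
    have h1 : v ∈ envPattern κ K (Set.Ioo 0 (0 + l)) ∅ := by
      refine ⟨fun z hz => hz.elim, fun z hz => hv.2 z ⟨⟨hz.1.1, ?_⟩, hz.2⟩⟩
      have := hz.1.2
      push_cast
      omega
    -- The site `l` starts the second piece, so its non-reasonableness is discarded.
    have h2 : v ∈ envPattern κ K (Set.Ioo (0 + l) (0 + l + L)) ∅ := by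
      refine ⟨fun z hz => hz.elim, fun z hz => hv.2 z ⟨⟨?_, ?_⟩, hz.2⟩⟩
      · have := hz.1.1
        omega
      · have := hz.1.2
        push_cast
        omega
    rw [patternBridge, patternBridge, patternBridge, Set.indicator_of_mem hv,
      Set.indicator_of_mem h1, Set.indicator_of_mem h2]
    exact bridgeWeight_add_le v 0 hl hn
  rw [← lintegral_patternBridge_empty hν κ K 0 l l,
    ← lintegral_patternBridge_empty hν κ K (0 + l) L n,
    ← hν.lintegral_mul (measurable_patternBridge ..) (measurable_patternBridge ..) _ _
      (disjoint_Ico_int 0 l n)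
      (dependsOn_patternBridge _ _ (fun z hz => ⟨hz.1.le, hz.2⟩) (Set.empty_subset _))
      (dependsOn_patternBridge _ _ (fun z hz => ⟨hz.1.le, by have := hz.2; omega⟩)
        (Set.empty_subset _)),
    ← lintegral_const_mul _ (measurable_patternBridge_mul ..)]
  exact lintegral_mono hpt

theorem expNeg_antitone : Antitone expNeg := by
  intro a b h
  refine EReal.exp_monotone ?_
  rw [EReal.neg_le_neg_iff]
  exact EReal.coe_ennreal_le_coe_ennreal_iff.2 h

/-- The starting point of a bridge is reasonable with positive conditional probability. -/
theorem mul_meanBridge_le_lintegral_reasonable [IsProbabilityMeasure ν] (hν : IsIIDEnvironment ν)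
    (κ K : ℝ≥0) (x : ℤ) (n : ℕ) :
    expNeg K * ν {v | v 0 ∈ Set.Icc (κ : ℝ≥0∞) K} * meanBridge ν (n + 1) ≤
      ∫⁻ v, patternBridge κ K {x} {x} x (n + 1) v ∂ν := by
  set A : Set (ℤ → ℝ≥0∞) := {v | v x ∈ Set.Icc (κ : ℝ≥0∞) K}
  have hA : MeasurableSet A := measurable_pi_apply x measurableSet_Icc
  have hνA : ν A = ν {v | v 0 ∈ Set.Icc (κ : ℝ≥0∞) K} := by
    have hm : MeasurableSet {v : ℤ → ℝ≥0∞ | v 0 ∈ Set.Icc (κ : ℝ≥0∞) K} :=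
      measurable_pi_apply 0 measurableSet_Icc
    rw [← (hν.shift x).measure_preimage hm.nullMeasurableSet]
    simp [A]
  -- All factors except the step weight at `x`; they depend only on sites to the right of `x`, hence
  -- are independent of the potential at `x`.
  set T : (ℤ → ℝ≥0∞) → ℝ≥0∞ := fun v =>
    ENNReal.ofReal (∏ k ∈ Finset.range n, crossRatio (stepWeight v) 0 x (k + 1))
  have hT : Measurable T := ENNReal.measurable_ofReal.comp
    (Finset.measurable_prod _ fun k _ => measurable_crossRatio 0 x (k + 1))
  have hsplit : ∀ v, bridgeWeight v x (n + 1) = ENNReal.ofReal (stepWeight v x) * T v := by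
    intro v
    rw [bridgeWeight, bridge, Finset.prod_range_succ', mul_comm,
      ← ENNReal.ofReal_mul (stepWeight_nonneg v x)]
    rfl
  have hTdep : DependsOn T (Finset.Ioc x (x + n) : Finset ℤ) := by
    intro v w h
    refine congrArg ENNReal.ofReal (Finset.prod_congr rfl fun k hk => ?_)
    refine crossRatio_congr _ _ _ fun z h1 h2 => ?_
    have := Finset.mem_range.1 hk
    rw [stepWeight, stepWeight, h z (by simp [h1]; push_cast at h2; omega)]
  -- The step weight at `x` is at most `1/2` always and at least `e^{-K}/2` when `x` is reasonable;
  -- the quotient of these bounds is the factor `expNeg K`.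
  have hupper : meanBridge ν (n + 1) ≤ 2⁻¹ * ∫⁻ v, T v ∂ν := by
    rw [← lintegral_bridgeWeight hν x, ← lintegral_const_mul _ hT]
    refine lintegral_mono fun v => ?_
    rw [hsplit]
    gcongr
    calc ENNReal.ofReal (stepWeight v x) ≤ ENNReal.ofReal (1 / 2) :=
          ENNReal.ofReal_le_ofReal (stepWeight_le v x)
      _ = 2⁻¹ := by rw [one_div, ENNReal.ofReal_inv_of_pos two_pos]; simp
  have hlower : ∫⁻ v, A.indicator (fun _ => expNeg K * 2⁻¹) v * T v ∂ν ≤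
      ∫⁻ v, patternBridge κ K {x} {x} x (n + 1) v ∂ν := by
    refine lintegral_mono fun v => ?_
    by_cases hv : v ∈ A
    swap
    · rw [Set.indicator_of_notMem hv, zero_mul]
      exact zero_le
    have hv' : v ∈ envPattern κ K {x} {x} := by
      refine ⟨fun z hz => ?_, fun z hz => absurd hz.1 hz.2⟩
      rw [Set.mem_singleton_iff.1 hz]
      exact hv
    rw [Set.indicator_of_mem hv, patternBridge, Set.indicator_of_mem hv', hsplit,
      ← expNeg_mul_inv_two]
    gcongr
    exact expNeg_antitone hv.2
  have hdepA : DependsOn (A.indicator fun _ => expNeg K * 2⁻¹) ({x} : Finset ℤ) := by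
    intro v w h
    have hx : v x = w x := h x (by simp)
    simp only [Set.indicator, A, Set.mem_ofPred_eq, hx]
  refine le_trans ?_ hlower
  rw [hν.lintegral_mul (measurable_const.indicator hA) hT {x} (Finset.Ioc x (x + n)) (by simp)
    hdepA hTdep, lintegral_indicator hA, setLIntegral_const, hνA]
  calc expNeg K * ν {v | v 0 ∈ Set.Icc (κ : ℝ≥0∞) K} * meanBridge ν (n + 1)
      ≤ expNeg K * ν {v | v 0 ∈ Set.Icc (κ : ℝ≥0∞) K} * (2⁻¹ * ∫⁻ v, T v ∂ν) := by gcongr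
    _ = _ := by ring

/-- Decomposition of the bridges according to their first reasonable site. -/
theorem sum_gapBridge_mul_le [IsProbabilityMeasure ν] (hν : IsIIDEnvironment ν) (κ K : ℝ≥0)
    {N n : ℕ} (hN : N < n) :
    ∑ l ∈ Finset.Icc 1 N, expNeg K * ν {v | v 0 ∈ Set.Icc (κ : ℝ≥0∞) K} *
      (gapBridge ν κ K l l * meanBridge ν (n - l)) ≤ meanBridge ν n := by
  classical
  have hterm : ∀ l ∈ Finset.Icc 1 N, expNeg K * ν {v | v 0 ∈ Set.Icc (κ : ℝ≥0∞) K} *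
      (gapBridge ν κ K l l * meanBridge ν (n - l)) ≤
      ∫⁻ v, patternBridge κ K (Set.Ioo 0 (0 + l)) ∅ 0 l v *
        patternBridge κ K {0 + (l : ℤ)} {0 + (l : ℤ)} (0 + l) (n - l) v ∂ν := by
    intro l hl
    have hl' := Finset.mem_Icc.1 hl
    obtain ⟨j, hj⟩ : ∃ j, n - l = j + 1 := ⟨n - l - 1, by omega⟩
    rw [hν.lintegral_mul (measurable_patternBridge ..) (measurable_patternBridge ..) _ _
      (disjoint_Ico_int 0 l (n - l))
      (dependsOn_patternBridge _ _ (fun z hz => ⟨hz.1.le, hz.2⟩) (Set.empty_subset _))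
      (dependsOn_patternBridge _ _ (by simp; omega) (by simp; omega)),
      lintegral_patternBridge_empty hν, mul_left_comm]
    gcongr
    rw [hj]
    exact mul_meanBridge_le_lintegral_reasonable hν κ K (0 + l) j
  refine (Finset.sum_le_sum hterm).trans ?_
  rw [← lintegral_finsetSum _ fun l _ => measurable_patternBridge_mul ..]
  refine lintegral_mono fun v => ?_
  set R : ℕ → Prop := fun l => v (0 + (l : ℤ)) ∈ Set.Icc (κ : ℝ≥0∞) K
  have hR : ∀ l : ℕ, patternBridge κ K {0 + (l : ℤ)} {0 + (l : ℤ)} (0 + l) (n - l) v ≠ 0 → R l :=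
    fun l h => (Set.mem_of_indicator_ne_zero h).1 _ rfl
  have hnR : ∀ l m : ℕ, 1 ≤ m → m < l → R m →
      patternBridge κ K (Set.Ioo 0 (0 + l)) ∅ 0 l v = 0 := by
    intro l m h1 h2 hm
    refine Set.indicator_of_notMem (fun h => h.2 (0 + m) ⟨⟨by omega, by omega⟩, id⟩ hm) _
  -- For a fixed environment at most one summand is nonzero, the one at the first reasonable site.
  by_cases hex : ∃ l, 1 ≤ l ∧ l ≤ N ∧ R l
  · set l := Nat.find hex
    obtain ⟨h1, h2, h3⟩ := Nat.find_spec hex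
    rw [Finset.sum_eq_single_of_mem l (Finset.mem_Icc.2 ⟨h1, h2⟩)]
    · calc _ ≤ bridgeWeight v 0 l * bridgeWeight v (0 + l) (n - l) := by
            gcongr <;> exact patternBridge_le ..
        _ ≤ bridgeWeight v 0 (l + (n - l)) := bridgeWeight_mul_le v 0 l (n - l)
        _ = bridgeWeight v 0 n := by rw [Nat.add_sub_cancel' (by omega)]
    · intro b hb hbl
      have hb' := Finset.mem_Icc.1 hb
      rcases lt_or_gt_of_ne hbl with hlt | hlt
      · have : ¬ R b := fun h => Nat.find_min hex hlt ⟨hb'.1, hb'.2, h⟩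
        rw [not_not.1 (mt (hR b) this), mul_zero]
      · rw [hnR b l h1 hlt h3, zero_mul]
  · rw [Finset.sum_eq_zero]
    · exact zero_le
    intro l hl
    have hl' := Finset.mem_Icc.1 hl
    have : ¬ R l := fun h => hex ⟨l, hl'.1, hl'.2, h⟩
    rw [not_not.1 (mt (hR l) this), mul_zero]

end Averages

/-! ### The renewal inequality -/

/-- Divergence of the harmonic series makes the sum at least `2` when `θ = 1`, for a suitable `N`;
then `θ` is taken so close to `1` that `θ ^ N` is at least `1/2`. -/
theorem exists_lt_one_sum_ge {q : ℝ} (hq : 0 < q) :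
    ∃ (N : ℕ) (θ : ℝ≥0), 0 < θ ∧ θ < 1 ∧
      1 ≤ ∑ l ∈ Finset.Icc 1 N, q / (2 * l) * (θ : ℝ) ^ l := by
  have htend := Real.tendsto_sum_range_one_div_nat_succ_atTop
  obtain ⟨N, hN, hN1⟩ := ((Filter.tendsto_atTop.1 htend (4 / q)).and
    (Filter.eventually_ge_atTop 1)).exists
  have hN0 : (1 : ℝ) ≤ N := by exact_mod_cast hN1
  have hN2 : 1 / (2 * (N : ℝ)) ≤ 1 / 2 := by
    rw [div_le_div_iff₀ (by positivity) two_pos]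
    linarith
  have hN3 : 0 < 1 / (2 * (N : ℝ)) := by positivity
  set t : ℝ := 1 - 1 / (2 * N)
  have ht0 : 0 < t := by linarith
  have ht1 : t < 1 := by linarith
  -- Bernoulli's inequality; this is why `t` is `1 - 1 / (2 * N)`.
  have htN : 1 / 2 ≤ t ^ N := by
    have := one_add_mul_le_pow (a := -(1 / (2 * (N : ℝ)))) (by linarith) N
    have e : 1 + (N : ℝ) * -(1 / (2 * N)) = 1 / 2 := by field_simp; norm_num
    rw [e] at this
    simpa [t, sub_eq_add_neg] using this
  refine ⟨N, ⟨t, ht0.le⟩, ht0, ht1, ?_⟩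
  have hsum : ∑ l ∈ Finset.Icc 1 N, q / (2 * (l : ℝ)) =
      q / 2 * ∑ i ∈ Finset.range N, 1 / ((i : ℝ) + 1) := by
    rw [Finset.mul_sum, Finset.range_eq_Ico, ← Finset.Ico_add_one_right_eq_Icc,
      ← Finset.sum_Ico_add' (fun l : ℕ => q / (2 * (l : ℝ))) 0 N 1]
    refine Finset.sum_congr rfl fun i _ => ?_
    push_cast
    field_simp
  calc (1 : ℝ) = q / 2 * (4 / q) * (1 / 2) := by field_simp; norm_num
    _ ≤ (∑ l ∈ Finset.Icc 1 N, q / (2 * (l : ℝ))) * (1 / 2) := by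
        rw [hsum]
        gcongr
    _ ≤ ∑ l ∈ Finset.Icc 1 N, q / (2 * (l : ℝ)) * t ^ l := by
        rw [Finset.sum_mul]
        refine Finset.sum_le_sum fun l hl => ?_
        gcongr
        exact htN.trans (pow_le_pow_of_le_one ht0.le ht1.le (Finset.mem_Icc.1 hl).2)

/-- If splitting off a piece of a gap costs a factor proportional to its length, then the weight
of long gaps is exponentially small. -/
theorem gap_decay {β : ℕ → ℝ} {h : ℕ → ℕ → ℝ} {q θ : ℝ} {N : ℕ} (hq : 0 ≤ q) (hθ : 0 < θ)
    (hθ1 : θ < 1) (hh0 : ∀ L n, 0 ≤ h L n) (hhβ : ∀ L n, h L n ≤ β n)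
    (hsplit : ∀ l L n, 1 ≤ l → 1 ≤ n → L ≤ n → h (l + L) (l + n) ≤ 2 * l * (h l l * h L n))
    (hβ : ∀ n, N < n → ∑ l ∈ Finset.Icc 1 N, q * (h l l * β (n - l)) ≤ β n)
    (hN : 1 ≤ ∑ l ∈ Finset.Icc 1 N, q / (2 * l) * θ ^ l) (L n : ℕ) (hLn : L ≤ n) :
    h L n ≤ (θ ^ N)⁻¹ * θ ^ L * β n := by
  induction L using Nat.strong_induction_on generalizing n with
  | _ L ih =>
  have hβ0 : ∀ n, 0 ≤ β n := fun n => (hh0 0 n).trans (hhβ 0 n)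
  -- The prefactor `(θ ^ N)⁻¹` makes the bound trivial for `L ≤ N`; for longer gaps a first piece of
  -- length `l ≤ N` can be cut off.
  rcases le_or_gt L N with hL | hL
  · refine (hhβ L n).trans (le_mul_of_one_le_left (hβ0 n) ?_)
    rw [inv_mul_eq_div, one_le_div (by positivity)]
    exact pow_le_pow_of_le_one hθ.le hθ1.le hL
  -- The weight `q / (2 * l)` cancels the cutting cost `2 * l`, and `θ ^ l` restores the power lost
  -- in passing from `L` to `L - l`. What remains is a summand of `hβ`.
  · have key : ∀ l ∈ Finset.Icc 1 N, q / (2 * l) * θ ^ l * h L n ≤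
        (θ ^ N)⁻¹ * θ ^ L * (q * (h l l * β (n - l))) := by
      intro l hl
      obtain ⟨h1, h2⟩ := Finset.mem_Icc.1 hl
      have hl0 : (0 : ℝ) < l := by exact_mod_cast h1
      have s := hsplit l (L - l) (n - l) h1 (by omega) (by omega)
      rw [Nat.add_sub_cancel' (by omega), Nat.add_sub_cancel' (by omega)] at s
      have i := ih (L - l) (by omega) (n - l) (by omega)
      have e : θ ^ l * θ ^ (L - l) = θ ^ L := by rw [← pow_add, Nat.add_sub_cancel' (by omega)]
      calc q / (2 * l) * θ ^ l * h L n
          ≤ q / (2 * l) * θ ^ l * (2 * l * (h l l * ((θ ^ N)⁻¹ * θ ^ (L - l) * β (n - l)))) := by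
            have := hh0 l l
            gcongr
            exact s.trans (by gcongr)
        _ = (θ ^ N)⁻¹ * (θ ^ l * θ ^ (L - l)) * (q * (h l l * β (n - l))) := by field_simp
        _ = _ := by rw [e]
    calc h L n ≤ (∑ l ∈ Finset.Icc 1 N, q / (2 * l) * θ ^ l) * h L n :=
          le_mul_of_one_le_left (hh0 L n) hN
      _ ≤ ∑ l ∈ Finset.Icc 1 N, (θ ^ N)⁻¹ * θ ^ L * (q * (h l l * β (n - l))) := by
          rw [Finset.sum_mul]
          exact Finset.sum_le_sum key
      _ ≤ (θ ^ N)⁻¹ * θ ^ L * β n := by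
          rw [← Finset.mul_sum]
          exact mul_le_mul_of_nonneg_left (hβ n (by omega)) (by positivity)

/-- The annealed weight of the bridges that start with a gap of length `L` is exponentially small
in `L`. -/
theorem exists_gapBridge_le {ν : Measure (ℤ → ℝ≥0∞)} [IsProbabilityMeasure ν]
    (hν : IsIIDEnvironment ν) (κ K : ℝ≥0) (hp : 0 < ν {v | v 0 ∈ Set.Icc (κ : ℝ≥0∞) K}) :
    ∃ M θ : ℝ≥0, 1 ≤ M ∧ 0 < θ ∧ θ < 1 ∧ ∀ L n : ℕ, L ≤ n →
      gapBridge ν κ K L n ≤ (M : ℝ≥0∞) * (θ : ℝ≥0∞) ^ L * meanBridge ν n := by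
  set Q : ℝ≥0∞ := expNeg K * ν {v | v 0 ∈ Set.Icc (κ : ℝ≥0∞) K}
  have hQtop : Q ≠ ⊤ := ENNReal.mul_ne_top (expNeg_ne_top _) (measure_ne_top _ _)
  have hK : 0 < expNeg K := by
    rw [expNeg, EReal.zero_lt_exp_iff, bot_lt_iff_ne_bot, Ne, EReal.neg_eq_bot_iff]
    simp
  have hQ : 0 < Q.toReal := ENNReal.toReal_pos (mul_ne_zero hK.ne' hp.ne') hQtop
  obtain ⟨N, θ, hθ, hθ1, hN⟩ := exists_lt_one_sum_ge hQ
  have hm : ∀ n, meanBridge ν n ≠ ⊤ := fun n =>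
    ((meanBridge_le_one n).trans_lt ENNReal.one_lt_top).ne
  have hg : ∀ L n, gapBridge ν κ K L n ≠ ⊤ := fun L n =>
    ((gapBridge_le_meanBridge κ K L n).trans_lt (hm n).lt_top).ne
  have key := gap_decay (β := fun n => (meanBridge ν n).toReal)
    (h := fun L n => (gapBridge ν κ K L n).toReal) (q := Q.toReal) (θ := θ) (N := N) hQ.le
    (by exact_mod_cast hθ) (by exact_mod_cast hθ1) (fun _ _ => ENNReal.toReal_nonneg)
    (fun L n => ENNReal.toReal_mono (hm n) (gapBridge_le_meanBridge κ K L n))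
    (fun l L n h1 h2 h3 => by
      have h := ENNReal.toReal_mono (ENNReal.mul_ne_top (ENNReal.mul_ne_top (by simp)
        (ENNReal.natCast_ne_top l)) (ENNReal.mul_ne_top (hg l l) (hg L n)))
        (gapBridge_add_le hν κ K h1 h2 h3)
      simpa [ENNReal.toReal_mul] using h)
    (fun n hn => by
      have h := ENNReal.toReal_mono (hm n) (sum_gapBridge_mul_le hν κ K hn)
      rw [ENNReal.toReal_sum fun l _ => ENNReal.mul_ne_top hQtop
        (ENNReal.mul_ne_top (hg l l) (hm _))] at h
      simpa [ENNReal.toReal_mul, Q] using h) hN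
  refine ⟨(θ ^ N)⁻¹, θ, ?_, hθ, hθ1, fun L n hLn => ?_⟩
  · exact (one_le_inv₀ (by positivity)).2 (pow_le_one₀ θ.2 hθ1.le)
  · have h := ENNReal.ofReal_le_ofReal (key L n hLn)
    rw [ENNReal.ofReal_toReal (hg L n), ENNReal.ofReal_mul (by positivity),
      ENNReal.ofReal_toReal (hm n)] at h
    refine h.trans (le_of_eq ?_)
    congr 1
    rw [show ((θ : ℝ) ^ N)⁻¹ * (θ : ℝ) ^ L = (((θ ^ N)⁻¹ * θ ^ L : ℝ≥0) : ℝ) by push_cast; rfl,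
      ENNReal.ofReal_coe_nnreal]
    push_cast
    rfl

/-! ### Several gaps -/

section Gaps

variable {ν : Measure (ℤ → ℝ≥0∞)} {κ K g : ℝ≥0}

/-- The constant is 1 / (1 - e^{-κ}), which bounds the mean number of visits to a site with killing
at least κ. -/
theorem exists_killing_const (hκ : 0 < κ) :
    ∃ g : ℝ≥0, 1 ≤ g ∧ ∀ (v : ℤ → ℝ≥0∞) z, (κ : ℝ≥0∞) ≤ v z →
      1 ≤ (g : ℝ) * (1 - 2 * stepWeight v z) := by
  have h1 : expNeg κ < 1 := by
    rw [expNeg, EReal.exp_lt_one_iff, EReal.neg_lt_comm]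
    simpa using hκ
  have h2 : (expNeg κ).toReal < 1 := by
    simpa using (ENNReal.toReal_lt_toReal (expNeg_ne_top _) ENNReal.one_ne_top).2 h1
  have h3 : 0 < 1 - (expNeg κ).toReal := by linarith
  have h4 : 1 ≤ (1 - (expNeg κ).toReal)⁻¹ :=
    (one_le_inv₀ h3).2 (by linarith [ENNReal.toReal_nonneg (a := expNeg κ)])
  refine ⟨⟨(1 - (expNeg κ).toReal)⁻¹, by positivity⟩, h4, fun v z hz => ?_⟩
  have h5 := ENNReal.toReal_mono (expNeg_ne_top _) (expNeg_antitone hz)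
  change 1 ≤ (1 - (expNeg κ).toReal)⁻¹ * (1 - 2 * stepWeight v z)
  rw [inv_mul_eq_div, one_le_div h3, stepWeight]
  linarith

/-- Splitting of the bridges at their first reasonable site. -/
theorem lintegral_patternBridge_insert_le (hν : IsIIDEnvironment ν)
    (hg : ∀ (v : ℤ → ℝ≥0∞) z, (κ : ℝ≥0∞) ≤ v z → 1 ≤ (g : ℝ) * (1 - 2 * stepWeight v z))
    {x b : ℤ} {l n : ℕ} (hl : 1 ≤ l) (hn : 1 ≤ n) (hb : b ≤ x + l + n) (hlb : x + l < b) {X : Set ℤ}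
    (hX : X ⊆ Set.Ioo (x + l) b) :
    ∫⁻ v, patternBridge κ K (Set.Ioo x b) (insert (x + l) X) x (l + n) v ∂ν ≤
      g * (gapBridge ν κ K l l *
        ∫⁻ v, patternBridge κ K (Set.Ioo (x + l) b) X (x + l) n v ∂ν) := by
  rw [← lintegral_patternBridge_empty hν κ K x l l,
    ← hν.lintegral_mul (measurable_patternBridge ..) (measurable_patternBridge ..) _ _
      (disjoint_Ico_int x l n)
      (dependsOn_patternBridge _ _ (fun z hz => ⟨hz.1.le, hz.2⟩) (Set.empty_subset _))
      (dependsOn_patternBridge _ _ (fun z hz => ⟨hz.1.le, hz.2.trans_le hb⟩)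
        (fun z hz => ⟨(hX hz).1.le, (hX hz).2.trans_le hb⟩)),
    ← lintegral_const_mul _ (measurable_patternBridge_mul ..)]
  refine lintegral_mono fun v => ?_
  by_cases hv : v ∈ envPattern κ K (Set.Ioo x b) (insert (x + l) X)
  swap
  · rw [patternBridge, Set.indicator_of_notMem hv]
    exact zero_le
  have h1 : v ∈ envPattern κ K (Set.Ioo x (x + l)) ∅ := by
    refine ⟨fun z hz => hz.elim, fun z hz => hv.2 z ⟨⟨hz.1.1, hz.1.2.trans hlb⟩, ?_⟩⟩
    rintro (h | h)
    · exact hz.1.2.ne h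
    · exact absurd (hX h).1 hz.1.2.not_gt
  have h2 : v ∈ envPattern κ K (Set.Ioo (x + l) b) X := by
    refine ⟨fun z hz => hv.1 z (Or.inr hz), fun z hz => hv.2 z ⟨⟨?_, hz.1.2⟩, ?_⟩⟩
    · have := hz.1.1
      omega
    · rintro (h | h)
      · exact hz.1.1.ne' h
      · exact hz.2 h
  rw [patternBridge, patternBridge, patternBridge, Set.indicator_of_mem hv,
    Set.indicator_of_mem h1, Set.indicator_of_mem h2]
  exact bridgeWeight_add_le_of_killing v x hl hn (hg v _ (hv.1 _ (Or.inl rfl)).1)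

theorem range_succ_castSucc {m : ℕ} (x : Fin (m + 3) → ℤ) :
    (Set.range fun i : Fin (m + 1) => x i.succ.castSucc) =
      insert (x 1) (Set.range fun i : Fin m => x i.succ.castSucc.succ) := by
  ext z
  simp only [Set.mem_range, Set.mem_insert_iff, Fin.exists_fin_succ]
  refine or_congr ?_ Iff.rfl
  exact eq_comm

/-- The bridges from a site `x 0`, in environments whose reasonable sites near `x 0` are
prescribed. -/
theorem lintegral_patternBridge_le (hν : IsIIDEnvironment ν)
    (hg1 : 1 ≤ g)
    (hg : ∀ (v : ℤ → ℝ≥0∞) z, (κ : ℝ≥0∞) ≤ v z → 1 ≤ (g : ℝ) * (1 - 2 * stepWeight v z))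
    {M θ : ℝ≥0} (hgap : ∀ L n : ℕ, L ≤ n →
      gapBridge ν κ K L n ≤ (M : ℝ≥0∞) * (θ : ℝ≥0∞) ^ L * meanBridge ν n)
    (m : ℕ) (x : Fin (m + 2) → ℤ) (hx : StrictMono x) (n : ℕ)
    (hn : x (Fin.last (m + 1)) ≤ x 0 + n) :
    ∫⁻ v, patternBridge κ K (Set.Ioo (x 0) (x (Fin.last (m + 1))))
        (Set.range fun i : Fin m => x i.succ.castSucc) (x 0) n v ∂ν ≤
      (g * M : ℝ≥0∞) ^ (m + 1) * (θ : ℝ≥0∞) ^ (x (Fin.last (m + 1)) - x 0).toNat *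
        meanBridge ν n := by
  induction m generalizing n with
  | zero =>
    have h0 : x 0 < x (Fin.last 1) := hx (by simp)
    obtain ⟨L, hL⟩ := Int.eq_ofNat_of_zero_le (sub_nonneg.2 h0.le)
    have e : x (Fin.last (0 + 1)) = x 0 + L := by rw [← hL]; simp
    rw [Set.range_eq_empty, e, lintegral_patternBridge_empty hν, add_sub_cancel_left,
      Int.toNat_natCast, pow_one]
    refine (hgap L n (by omega)).trans ?_
    gcongr
    exact le_mul_of_one_le_left zero_le (by exact_mod_cast hg1)
  | succ m ih =>
    have h01 : x 0 < x 1 := hx (by simp)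
    have h1l : x 1 < x (Fin.last (m + 2)) := hx (by simp [Fin.lt_def])
    obtain ⟨l, hl⟩ := Int.eq_ofNat_of_zero_le (sub_nonneg.2 h01.le)
    have e1 : x 1 = x 0 + l := by rw [← hl]; simp
    have hn2 : x (Fin.last (m + 2)) ≤ x 0 + n := hn
    obtain ⟨n', rfl⟩ : ∃ n', n = l + n' := ⟨n - l, by omega⟩
    push_cast at hn2
    have hn' : x (Fin.last (m + 2)) ≤ x 0 + l + n' := by linarith
    have hstep := ih (fun i => x i.succ) (fun i j h => hx (Fin.succ_lt_succ_iff.2 h)) n'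
      (by simpa only [Fin.succ_zero_eq_one, Fin.succ_last, e1] using hn')
    simp only [Fin.succ_zero_eq_one, Fin.succ_last] at hstep
    rw [range_succ_castSucc, e1]
    have hXsub : (Set.range fun i : Fin m => x i.succ.castSucc.succ) ⊆
        Set.Ioo (x 0 + l) (x (Fin.last (m + 2))) := by
      rintro _ ⟨i, rfl⟩
      rw [← e1]
      exact ⟨hx (by simp [Fin.lt_def]), hx (by simp [Fin.lt_def])⟩
    refine (lintegral_patternBridge_insert_le hν hg (by omega) (by omega) hn' (by omega)
      hXsub).trans ?_
    rw [e1] at hstep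
    set b := x (Fin.last (m + 2))
    have eθ : (θ : ℝ≥0∞) ^ (b - x 0).toNat =
        (θ : ℝ≥0∞) ^ l * (θ : ℝ≥0∞) ^ (b - (x 0 + l)).toNat := by
      rw [← pow_add]
      congr 1
      omega
    -- The first gap spans its whole bridge (`L = n = l`), so it yields `meanBridge ν l`, which
    -- recombines with `meanBridge ν n'` without loss.
    calc (g : ℝ≥0∞) * (gapBridge ν κ K l l * _)
        ≤ g * ((M * (θ : ℝ≥0∞) ^ l * meanBridge ν l) * ((g * M : ℝ≥0∞) ^ (m + 1) *
          (θ : ℝ≥0∞) ^ (b - (x 0 + l)).toNat * meanBridge ν n')) := by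
          gcongr
          · exact hgap l l le_rfl
      _ = (g * M : ℝ≥0∞) ^ (m + 1 + 1) * (θ : ℝ≥0∞) ^ (b - x 0).toNat *
          (meanBridge ν l * meanBridge ν n') := by
          rw [eθ]; ring
      _ ≤ _ := by
          gcongr
          exact meanBridge_mul_le hν l n'

/-- Passage to bridges that start at `0`, by splitting them at their last reasonable site up to
`a`. -/
theorem lintegral_patternBridge_zero_le (hν : IsIIDEnvironment ν) (hg1 : 1 ≤ g)
    (hg : ∀ (v : ℤ → ℝ≥0∞) z, (κ : ℝ≥0∞) ≤ v z → 1 ≤ (g : ℝ) * (1 - 2 * stepWeight v z))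
    {D θ : ℝ≥0} (hθ : θ < 1) {b : ℤ} {X : Set ℤ} {n : ℕ} (hbn : b ≤ n) (a : ℕ) (hab : a < b)
    (hX : X ⊆ Set.Ioo (a : ℤ) b)
    (hD : ∀ u : ℕ, u ≤ a → ∫⁻ v, patternBridge κ K (Set.Ioo (u : ℤ) b) X u (n - u) v ∂ν ≤
      D * (θ : ℝ≥0∞) ^ (b - u).toNat * meanBridge ν (n - u)) :
    ∫⁻ v, patternBridge κ K (Set.Ioo (a : ℤ) b) X 0 n v ∂ν ≤
      (g * (1 - θ)⁻¹ * D : ℝ≥0) * (θ : ℝ≥0∞) ^ (b - a).toNat * meanBridge ν n := by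
  have hθ' : 0 < 1 - θ := tsub_pos_of_lt hθ
  have hc1 : 1 ≤ (1 - θ)⁻¹ := (one_le_inv₀ hθ').2 tsub_le_self
  -- The geometric sum as a fixed point of c ↦ c θ + 1, which is how the constant changes in the
  -- induction step below.
  have hc : (1 - θ)⁻¹ * θ + 1 = (1 - θ)⁻¹ := by
    have : (1 - θ)⁻¹ * θ + (1 - θ)⁻¹ * (1 - θ) = (1 - θ)⁻¹ := by
      rw [← mul_add, add_tsub_cancel_of_le hθ.le, mul_one]
    rwa [inv_mul_cancel₀ hθ'.ne'] at this
  induction a with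
  | zero =>
    refine (hD 0 le_rfl).trans ?_
    rw [Nat.sub_zero]
    gcongr
    exact le_mul_of_one_le_left zero_le (one_le_mul hg1 hc1)
  | succ a ih =>
    push_cast at hab hX
    have hXa : X ⊆ Set.Ioo (a : ℤ) b := fun z hz =>
      ⟨by have := (hX hz).1; omega, (hX hz).2⟩
    have hJ := ih (by omega) hXa fun u hu => hD u (by omega)
    have hDa := hD (a + 1) le_rfl
    have hna : a + 1 + (n - (a + 1)) = n := by omega
    have e0 : ((a + 1 : ℕ) : ℤ) = 0 + (a + 1 : ℕ) := by omega
    have hsub : Set.Ioo (0 + ((a + 1 : ℕ) : ℤ)) b ⊆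
        Set.Ico (0 + ((a + 1 : ℕ) : ℤ)) (0 + ((a + 1 : ℕ) : ℤ) + (n - (a + 1) : ℕ)) := fun z hz =>
      ⟨hz.1.le, by have := hz.2; omega⟩
    -- If `a + 1` is reasonable, the bridge is cut there; otherwise the gap extends to the left and
    -- the induction hypothesis at `a` applies.
    have hpt : ∀ v, patternBridge κ K (Set.Ioo ((a + 1 : ℕ) : ℤ) b) X 0 n v ≤
        patternBridge κ K (Set.Ioo (a : ℤ) b) X 0 n v + g * (bridgeWeight v 0 (a + 1) *
          patternBridge κ K (Set.Ioo (0 + ((a + 1 : ℕ) : ℤ)) b) X (0 + (a + 1 : ℕ))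
            (n - (a + 1)) v) := by
      intro v
      by_cases hv : v ∈ envPattern κ K (Set.Ioo ((a + 1 : ℕ) : ℤ) b) X
      swap
      · rw [patternBridge, Set.indicator_of_notMem hv]
        exact zero_le
      by_cases ha : v ((a + 1 : ℕ) : ℤ) ∈ Set.Icc (κ : ℝ≥0∞) K
      · refine le_add_left ?_
        rw [patternBridge, patternBridge, Set.indicator_of_mem hv, ← e0, Set.indicator_of_mem hv]
        have := bridgeWeight_add_le_of_killing (g := g) v 0 (a := a + 1) (b := n - (a + 1))
          (by omega) (by omega) (hg v _ (by rw [← e0]; exact ha.1))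
        rwa [hna, ← e0] at this
      · refine le_add_right ?_
        have hv' : v ∈ envPattern κ K (Set.Ioo (a : ℤ) b) X := by
          refine ⟨hv.1, fun z hz => ?_⟩
          by_cases hza : z = ((a + 1 : ℕ) : ℤ)
          · rw [hza]
            exact ha
          · exact hv.2 z ⟨⟨by have := hz.1.1; omega, hz.1.2⟩, hz.2⟩
        rw [patternBridge, patternBridge, Set.indicator_of_mem hv, Set.indicator_of_mem hv']
    have hmeas : Measurable fun v => bridgeWeight v 0 (a + 1) *
        patternBridge κ K (Set.Ioo (0 + ((a + 1 : ℕ) : ℤ)) b) X (0 + (a + 1 : ℕ))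
          (n - (a + 1)) v :=
      (measurable_bridgeWeight ..).mul (measurable_patternBridge ..)
    refine (lintegral_mono hpt).trans ?_
    rw [lintegral_add_left (measurable_patternBridge ..), lintegral_const_mul _ hmeas,
      hν.lintegral_mul (measurable_bridgeWeight ..) (measurable_patternBridge ..) _ _
        (disjoint_Ico_int 0 (a + 1) (n - (a + 1))) (dependsOn_bridgeWeight _ _)
        (dependsOn_patternBridge _ _ hsub (fun z hz => hsub ⟨by have := (hX hz).1; omega,
          (hX hz).2⟩)), lintegral_bridgeWeight hν, ← e0]
    set k := (b - ((a + 1 : ℕ) : ℤ)).toNat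
    have ek : (b - (a : ℤ)).toNat = k + 1 := by omega
    rw [ek] at hJ
    calc _ ≤ (g * (1 - θ)⁻¹ * D : ℝ≥0) * (θ : ℝ≥0∞) ^ (k + 1) * meanBridge ν n +
          g * (meanBridge ν (a + 1) * (D * (θ : ℝ≥0∞) ^ k * meanBridge ν (n - (a + 1)))) := by
          gcongr
      _ = (g * (1 - θ)⁻¹ * D : ℝ≥0) * (θ : ℝ≥0∞) ^ (k + 1) * meanBridge ν n +
          g * D * (θ : ℝ≥0∞) ^ k * (meanBridge ν (a + 1) * meanBridge ν (n - (a + 1))) := by ring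
      _ ≤ (g * (1 - θ)⁻¹ * D : ℝ≥0) * (θ : ℝ≥0∞) ^ (k + 1) * meanBridge ν n +
          g * D * (θ : ℝ≥0∞) ^ k * meanBridge ν n := by
          gcongr
          have := meanBridge_mul_le hν (a + 1) (n - (a + 1))
          rwa [hna] at this
      _ = (g * ((1 - θ)⁻¹ * θ + 1) * D : ℝ≥0) * (θ : ℝ≥0∞) ^ k * meanBridge ν n := by
          push_cast
          ring
      _ = _ := by rw [hc]

/-- The annealed weight of the bridges from `0` with prescribed reasonable sites. -/
theorem exists_lintegral_patternBridge_le [IsProbabilityMeasure ν] (hν : IsIIDEnvironment ν)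
    (hκ : 0 < κ) (hp : 0 < ν {v | v 0 ∈ Set.Icc (κ : ℝ≥0∞) K}) :
    ∃ M θ : ℝ≥0, 0 < θ ∧ θ < 1 ∧ ∀ (m : ℕ) (x : Fin (m + 2) → ℤ), StrictMono x → 0 ≤ x 0 →
      ∀ n : ℕ, x (Fin.last (m + 1)) ≤ n →
        ∫⁻ v, patternBridge κ K (Set.Ioo (x 0) (x (Fin.last (m + 1))))
          (Set.range fun i : Fin m => x i.succ.castSucc) 0 n v ∂ν ≤
        (M : ℝ≥0∞) ^ (m + 1) * (θ : ℝ≥0∞) ^ (x (Fin.last (m + 1)) - x 0).toNat *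
          meanBridge ν n := by
  obtain ⟨g, hg1, hg⟩ := exists_killing_const hκ
  obtain ⟨M, θ, hM, hθ, hθ1, hgap⟩ := exists_gapBridge_le hν κ K hp
  have hc1 : 1 ≤ (1 - θ)⁻¹ := (one_le_inv₀ (tsub_pos_of_lt hθ1)).2 tsub_le_self
  refine ⟨g * (1 - θ)⁻¹ * (g * M), θ, hθ, hθ1, fun m x hx hx0 n hn => ?_⟩
  obtain ⟨a, ha⟩ := Int.eq_ofNat_of_zero_le hx0
  set b := x (Fin.last (m + 1))
  have hab : x 0 < b := hx (by simp [Fin.lt_def])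
  have hX : (Set.range fun i : Fin m => x i.succ.castSucc) ⊆ Set.Ioo (x 0) b := by
    rintro _ ⟨i, rfl⟩
    exact ⟨hx (by simp [Fin.lt_def]), hx (by simp [Fin.lt_def])⟩
  have key := lintegral_patternBridge_zero_le (K := K) (D := (g * M) ^ (m + 1))
    (X := Set.range fun i : Fin m => x i.succ.castSucc) hν hg1 hg hθ1 hn a
    (by rwa [← ha]) (by rwa [← ha]) (by
      intro u hu
      -- The same configuration with its left end `x 0` moved back to `u`.
      have hmono : StrictMono (Fin.cons (u : ℤ) (fun i : Fin (m + 1) => x i.succ) :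
          Fin (m + 2) → ℤ) := by
        refine Fin.strictMono_iff_lt_succ.2 fun i => ?_
        refine Fin.cases ?_ (fun j => ?_) i
        · have : x 0 < x 1 := hx (by simp)
          rw [Fin.castSucc_zero, Fin.cons_zero, Fin.cons_succ, Fin.succ_zero_eq_one]
          omega
        · rw [← Fin.succ_castSucc, Fin.cons_succ, Fin.cons_succ]
          exact hx (by simp [Fin.lt_def])
      have h := lintegral_patternBridge_le (K := K) hν hg1 hg hgap m _ hmono (n - u) (by
        rw [← Fin.succ_last, Fin.cons_succ, Fin.cons_zero, Fin.succ_last]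
        change b ≤ _
        omega)
      have e2 : ∀ i : Fin m, (Fin.cons (u : ℤ) (fun i : Fin (m + 1) => x i.succ) :
          Fin (m + 2) → ℤ) i.succ.castSucc = x i.succ.castSucc := by
        intro i
        rw [← Fin.succ_castSucc, Fin.cons_succ]
      simp only [e2] at h
      rw [← Fin.succ_last, Fin.cons_succ, Fin.cons_zero, Fin.succ_last] at h
      refine h.trans (le_of_eq ?_)
      push_cast
      rfl)
  rw [ha]
  refine key.trans ?_
  gcongr
  -- The prefactor `g * (1 - θ)⁻¹` occurs once; being at least `1`, it is absorbed into the `m + 1`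
  -- factors.
  rw [← ENNReal.coe_pow, ENNReal.coe_le_coe, mul_pow (g * (1 - θ)⁻¹)]
  gcongr
  exact le_self_pow₀ (one_le_mul hg1 hc1) (by omega)

end Gaps

/-! ### Comparison of the weighted walk with its bridges -/

section Comparison

variable {ν : Measure (ℤ → ℝ≥0∞)} {κ K : ℝ≥0}

theorem measurable_partition (y x : ℤ) : Measurable fun v => partition v y x := by
  have : IsProbabilityMeasure (srw x) := by unfold srw; infer_instance
  exact (measurable_weight (V := fun z (v : ℤ → ℝ≥0∞) => v z)
    (fun z => measurable_pi_apply z) y).lintegral_prod_right'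

/-- The environments without reasonable sites strictly between `-(k + 1)` and `0`. -/
abbrev leftGap (κ K : ℝ≥0) (k : ℕ) : Set (ℤ → ℝ≥0∞) :=
  envPattern κ K (Set.Ioo (-(k + 1 : ℕ)) 0) ∅

theorem measure_leftGap [IsProbabilityMeasure ν] (hν : IsIIDEnvironment ν) (k : ℕ) :
    ν (leftGap κ K k) = (1 - ν {v | v 0 ∈ Set.Icc (κ : ℝ≥0∞) K}) ^ k := by
  have h := hν.indep.measure_inter_preimage_eq_mul (Finset.Ioo (-((k + 1 : ℕ) : ℤ)) 0)
    (sets := fun _ => (Set.Icc (κ : ℝ≥0∞) K)ᶜ) (fun _ _ => measurableSet_Icc.compl)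
  have h0 : MeasurableSet {v : ℤ → ℝ≥0∞ | v 0 ∈ Set.Icc (κ : ℝ≥0∞) K} :=
    measurable_pi_apply 0 measurableSet_Icc
  have h1 : ∀ z : ℤ, ν ((fun v : ℤ → ℝ≥0∞ => v z) ⁻¹' (Set.Icc (κ : ℝ≥0∞) K)ᶜ) =
      1 - ν {v | v 0 ∈ Set.Icc (κ : ℝ≥0∞) K} := by
    intro z
    rw [← prob_compl_eq_one_sub h0, ← (hν.shift z).measure_preimage h0.compl.nullMeasurableSet]
    simp [Set.preimage, Set.compl_def]
  have e : leftGap κ K k = ⋂ z ∈ Finset.Ioo (-((k + 1 : ℕ) : ℤ)) 0,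
      (fun v : ℤ → ℝ≥0∞ => v z) ⁻¹' (Set.Icc (κ : ℝ≥0∞) K)ᶜ := by
    ext v
    simp only [reasonableExactly, Set.mem_ofPred_eq, Set.mem_empty_iff_false, false_imp_iff,
      forall_const, true_and, Set.sdiff_empty, Set.mem_iInter, Finset.mem_Ioo, Set.mem_Ioo,
      Set.mem_preimage, Set.mem_compl_iff]
  rw [e, h, Finset.prod_congr rfl fun z _ => h1 z, Finset.prod_const, Int.card_Ioo]
  congr 1
  omega

/-- A cost linear in `k` against the geometric tail of the distance to the first reasonable site on
the left. -/
theorem tsum_leftGap_ne_top [IsProbabilityMeasure ν] (hν : IsIIDEnvironment ν)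
    (hp : 0 < ν {v | v 0 ∈ Set.Icc (κ : ℝ≥0∞) K}) (g : ℝ≥0) :
    ∑' k : ℕ, ENNReal.ofReal (2 * (g + k)) * ν (leftGap κ K k) ≠ ⊤ := by
  set r := 1 - ν {v | v 0 ∈ Set.Icc (κ : ℝ≥0∞) K}
  have hr1 : r < 1 := ENNReal.sub_lt_self ENNReal.one_ne_top one_ne_zero hp.ne'
  have hrt : r ≠ ⊤ := hr1.ne_top
  have hr : ‖r.toReal‖ < 1 := by
    rw [Real.norm_of_nonneg ENNReal.toReal_nonneg]
    simpa using (ENNReal.toReal_lt_toReal hrt ENNReal.one_ne_top).2 hr1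
  have hsum : Summable fun k : ℕ => 2 * ((g : ℝ) + k) * r.toReal ^ k := by
    have h1 := (summable_pow_mul_geometric_of_norm_lt_one 1 hr).mul_left 2
    have h2 := (summable_geometric_of_norm_lt_one hr).mul_left (2 * (g : ℝ))
    refine (h2.add h1).congr fun k => ?_
    ring
  have he : ∀ k : ℕ, ENNReal.ofReal (2 * (g + k)) * ν (leftGap κ K k) =
      ENNReal.ofReal (2 * ((g : ℝ) + k) * r.toReal ^ k) := by
    intro k
    rw [measure_leftGap hν, ENNReal.ofReal_mul (q := r.toReal ^ k) (by positivity),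
      ENNReal.ofReal_pow ENNReal.toReal_nonneg, ENNReal.ofReal_toReal hrt]
  simp only [he]
  exact hsum.tsum_ofReal_ne_top

/-- Restricting the walk to bridges costs a bounded factor, uniformly over the events that depend
on the environment between the end points only. -/
theorem exists_lintegral_partition_le [IsProbabilityMeasure ν] (hν : IsIIDEnvironment ν)
    (hκ : 0 < κ) (hp : 0 < ν {v | v 0 ∈ Set.Icc (κ : ℝ≥0∞) K}) :
    ∃ C : ℝ≥0, ∀ (n : ℕ) (I X : Set ℤ), 1 ≤ n → I ⊆ Set.Ico 0 (n : ℤ) → X ⊆ Set.Ico 0 (n : ℤ) →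
      ∫⁻ v, (envPattern κ K I X).indicator (fun v => partition v n 0) v ∂ν ≤
        C * ∫⁻ v, patternBridge κ K I X 0 n v ∂ν := by
  obtain ⟨g, hg1, hg⟩ := exists_killing_const hκ
  have htop := tsum_leftGap_ne_top (κ := κ) (K := K) hν hp g
  have hmeas : ∀ k, MeasurableSet (leftGap κ K k) := fun k => measurableSet_envPattern ..
  -- Borel–Cantelli: almost surely some `leftGap` event fails, and this produces a reasonable site
  -- on the left.
  have hall : ∀ᵐ v ∂ν, ∃ k : ℕ, v (-(k + 1 : ℕ)) ∈ Set.Icc (κ : ℝ≥0∞) K := by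
    have hfin : ∑' k, ν (leftGap κ K k) ≠ ⊤ := by
      refine ne_top_of_le_ne_top htop (ENNReal.tsum_le_tsum fun k => ?_)
      refine le_mul_of_one_le_left zero_le (ENNReal.one_le_ofReal.2 ?_)
      have h1 : (1 : ℝ) ≤ g := by exact_mod_cast hg1
      have h2 : (0 : ℝ) ≤ k := k.cast_nonneg
      linarith
    filter_upwards [ae_eventually_notMem hfin] with v hv
    obtain ⟨k, hk⟩ := hv.exists
    by_contra! hne
    refine hk ⟨fun z hz => hz.elim, fun z hz => ?_⟩
    have hz0 := hz.1.2
    have := hne (-z - 1).toNat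
    rwa [show -(((-z - 1).toNat + 1 : ℕ) : ℤ) = z by omega] at this
  refine ⟨(∑' k : ℕ, ENNReal.ofReal (2 * (g + k)) * ν (leftGap κ K k)).toNNReal,
    fun n I X hn hI hX => ?_⟩
  rw [ENNReal.coe_toNNReal htop]
  have hpt : ∀ᵐ v ∂ν, (envPattern κ K I X).indicator (fun v => partition v n 0) v ≤
      ∑' k : ℕ, ENNReal.ofReal (2 * (g + k)) *
        ((leftGap κ K k).indicator 1 v * patternBridge κ K I X 0 n v) := by
    classical
    filter_upwards [hall] with v hex
    by_cases hv : v ∈ envPattern κ K I X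
    swap
    · rw [Set.indicator_of_notMem hv]
      exact zero_le
    set k := Nat.find hex
    have hk : v ∈ leftGap κ K k := by
      refine ⟨fun z hz => hz.elim, fun z hz hzv => ?_⟩
      have h1 := hz.1.1
      have h2 := hz.1.2
      refine Nat.find_min hex (m := (-z - 1).toNat) (by omega) ?_
      rwa [show -(((-z - 1).toNat + 1 : ℕ) : ℤ) = z by omega]
    -- Only the gap up to the first reasonable site is kept in the summand. It depends on finitely
    -- many negative sites and is thus independent of the bridge, which uses sites in `[0, n)`.
    refine le_trans ?_ (ENNReal.le_tsum k)
    rw [Set.indicator_of_mem hv, Set.indicator_of_mem hk, patternBridge, Set.indicator_of_mem hv,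
      Pi.one_apply, one_mul]
    obtain ⟨j, rfl⟩ := Nat.exists_eq_add_of_le' hn
    exact partition_le_bridgeWeight v j k (by exact_mod_cast one_pos.trans_le hg1)
      (hg v _ (Nat.find_spec hex).1)
  refine (lintegral_mono_ae hpt).trans (le_of_eq ?_)
  have hmk : ∀ k, Measurable fun v => (leftGap κ K k).indicator (1 : (ℤ → ℝ≥0∞) → ℝ≥0∞) v *
      patternBridge κ K I X 0 n v := fun k =>
    (measurable_one.indicator (hmeas k)).mul (measurable_patternBridge ..)
  rw [lintegral_tsum fun k => ((hmk k).const_mul _).aemeasurable, ← ENNReal.tsum_mul_right]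
  refine tsum_congr fun k => ?_
  have hdep : DependsOn ((leftGap κ K k).indicator (1 : (ℤ → ℝ≥0∞) → ℝ≥0∞))
      (Finset.Ioo (-((k + 1 : ℕ) : ℤ)) 0 : Finset ℤ) := by
    intro v w h
    have hmem : v ∈ leftGap κ K k ↔ w ∈ leftGap κ K k := by
      refine and_congr (forall₂_congr fun z hz => hz.elim) (forall₂_congr fun z hz => ?_)
      simp only [h z (by simpa using hz.1)]
    by_cases hv : v ∈ leftGap κ K k
    · rw [Set.indicator_of_mem hv, Set.indicator_of_mem (hmem.1 hv)]
      rfl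
    · rw [Set.indicator_of_notMem hv, Set.indicator_of_notMem (mt hmem.2 hv)]
  have hdisj : Disjoint (Finset.Ioo (-((k + 1 : ℕ) : ℤ)) 0) (Finset.Ico (0 : ℤ) (0 + n)) := by
    refine Finset.disjoint_left.2 fun z h1 h2 => ?_
    simp only [Finset.mem_Ico, Finset.mem_Ioo] at h1 h2
    omega
  rw [lintegral_const_mul _ (hmk k), hν.lintegral_mul (measurable_one.indicator (hmeas k))
    (measurable_patternBridge ..) _ _ hdisj hdep (dependsOn_patternBridge _ _ (by simpa using hI)
      (by simpa using hX)), lintegral_indicator_one (hmeas k), mul_assoc]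

end Comparison

/-! ### The measures on environments and paths -/

section Measures

variable {Ω : Type*} [MeasurableSpace Ω] {P : Measure Ω} {V : ℤ → Ω → ℝ≥0∞}

/-- The event that the killed walk hits `n` before its second visit to `0`. -/
abbrev bridgeEvent (Ω : Type*) (n : ℕ) : Set (Ω × (ℕ → Option ℤ)) :=
  {q | hitTime q.2 (some (n : ℤ)) < secondHitTime q.2 (some 0) ∧ hitTime q.2 (some (n : ℤ)) < ⊤}

theorem measurableSet_bridgeEvent (n : ℕ) : MeasurableSet (bridgeEvent Ω n) :=
  (measurableSet_lt_enat ((measurable_hitTime _).comp measurable_snd)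
    ((measurable_secondHitTime _).comp measurable_snd)).inter
    (measurableSet_lt_enat ((measurable_hitTime _).comp measurable_snd) measurable_const)

theorem killedAveraged_bridgeEvent [IsProbabilityMeasure P] (hV : ∀ z, Measurable (V z)) (n : ℕ)
    {E : Set Ω} (hE : MeasurableSet E) :
    killedAveraged P V hV 0 (bridgeEvent Ω (n + 1) ∩ {q | q.1 ∈ E}) =
      ∫⁻ ω, E.indicator (fun ω => bridgeWeight (fun z => V z ω) 0 (n + 1)) ω ∂P := by
  have hE' : MeasurableSet {q : Ω × (ℕ → Option ℤ) | q.1 ∈ E} := measurable_fst hE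
  rw [killedAveraged, Measure.compProd_apply ((measurableSet_bridgeEvent (n + 1)).inter hE')]
  refine lintegral_congr fun ω => ?_
  by_cases hω : ω ∈ E
  · rw [Set.indicator_of_mem hω, bridgeWeight, ← chainLaw_killed_bridge]
    change chainLaw (killedKernel fun z => V z ω) (some 0) _ = _
    congr 1
    ext s
    simp [hω]
  · rw [Set.indicator_of_notMem hω]
    have : Prod.mk ω ⁻¹' (bridgeEvent Ω (n + 1) ∩ {q | q.1 ∈ E}) = ∅ := by
      ext s
      simp [hω]
    rw [this, measure_empty]

theorem weightedMeasure_fst [IsProbabilityMeasure P] (hV : ∀ z, Measurable (V z)) (y : ℤ)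
    {E : Set Ω} (hE : MeasurableSet E) :
    weightedMeasure P V 0 y {q | q.1 ∈ E} =
      ∫⁻ ω, E.indicator (fun ω => partition (fun z => V z ω) y 0) ω ∂P := by
  have : IsProbabilityMeasure (srw 0) := by unfold srw; infer_instance
  have hE' : MeasurableSet {q : Ω × (ℕ → ℤ) | q.1 ∈ E} := measurable_fst hE
  rw [weightedMeasure, withDensity_apply _ hE', ← lintegral_indicator hE',
    lintegral_prod _ ((measurable_weight hV y).indicator hE').aemeasurable]
  refine lintegral_congr fun ω => ?_
  by_cases hω : ω ∈ E
  · rw [Set.indicator_of_mem hω, partition]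
    refine lintegral_congr fun s => ?_
    rw [Set.indicator_of_mem (by exact hω)]
    rfl
  · rw [Set.indicator_of_notMem hω]
    simp [Set.indicator, hω]

theorem lintegral_indicator_env (hV : ∀ z, Measurable (V z)) (κ K : ℝ≥0) (I X : Set ℤ)
    {F : (ℤ → ℝ≥0∞) → ℝ≥0∞} (hF : Measurable F) :
    ∫⁻ ω, (reasonableExactly V κ K I X).indicator (fun ω => F fun z => V z ω) ω ∂P =
      ∫⁻ v, (envPattern κ K I X).indicator F v ∂P.map fun ω z => V z ω := by
  rw [lintegral_map (hF.indicator (measurableSet_envPattern κ K I X)) (measurable_pi_iff.2 hV)]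
  rfl

end Measures

theorem prod_mul_zpow_sub {M θ : ℝ} (hθ : θ ≠ 0) {m : ℕ} (x : Fin (m + 2) → ℤ) :
    ∏ j : Fin (m + 1), M * θ ^ (x j.succ - x j.castSucc) =
      M ^ (m + 1) * θ ^ (x (Fin.last (m + 1)) - x 0) := by
  rw [Finset.prod_mul_distrib, Finset.prod_const, Finset.card_univ, Fintype.card_fin]
  congr 1
  induction m with
  | zero => simp
  | succ m ih =>
    rw [Fin.prod_univ_castSucc]
    have := ih fun i => x i.castSucc
    simp only [← Fin.succ_castSucc] at this ⊢
    rw [this, ← zpow_add₀ hθ]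
    congr 1
    simp

theorem ofReal_prod_mul_zpow_sub {M θ : ℝ≥0} (hθ : 0 < θ) {m : ℕ} {x : Fin (m + 2) → ℤ}
    (hx : StrictMono x) :
    ENNReal.ofReal (∏ j : Fin (m + 1), (M : ℝ) * (θ : ℝ) ^ (x j.succ - x j.castSucc)) =
      (M : ℝ≥0∞) ^ (m + 1) * (θ : ℝ≥0∞) ^ (x (Fin.last (m + 1)) - x 0).toNat := by
  rw [prod_mul_zpow_sub (by exact_mod_cast hθ.ne')]
  have h0 : x 0 ≤ x (Fin.last (m + 1)) := hx.monotone (Fin.zero_le _)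
  obtain ⟨k, hk⟩ := Int.eq_ofNat_of_zero_le (sub_nonneg.2 h0)
  rw [hk, Int.toNat_natCast, zpow_natCast, ← NNReal.coe_pow, ← NNReal.coe_pow, ← NNReal.coe_mul,
    ENNReal.ofReal_coe_nnreal]
  push_cast
  rfl

/-- Covers a vanishing normalising constant as well: then `B = 0`, and the product is `0` although
`c⁻¹ = ⊤`. -/
theorem inv_mul_mul_le {c D B : ℝ≥0∞} (h : B ≤ c) (hc : c ≠ ⊤) : c⁻¹ * (D * B) ≤ D := by
  by_cases h0 : c = 0
  · have : B = 0 := le_antisymm (h.trans h0.le) zero_le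
    simp [this]
  · calc c⁻¹ * (D * B) ≤ c⁻¹ * (D * c) := by gcongr
      _ = D * (c⁻¹ * c) := by ring
      _ = D := by rw [ENNReal.inv_mul_cancel h0 hc, mul_one]

end RandomPotential

end

/-! ### The two exponential bounds -/

open RandomPotential

theorem theorem4p1 {Ω : Type*} [MeasurableSpace Ω] (P : Measure Ω) [IsProbabilityMeasure P]
    (V : ℤ → Ω → ℝ≥0∞) (hV : ∀ z, Measurable (V z))
    (hindep : iIndepFun V P) (hident : ∀ z, IdentDistrib (V z) (V 0) P P)
    (κ K : ℝ≥0) (hκ : 0 < κ) (hκK : 0 < P {ω | V 0 ω ∈ Set.Icc (κ : ℝ≥0∞) K}) :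
    ∃ M₁ M₂ θ : ℝ, 0 < θ ∧ θ < 1 ∧
      ∀ (m : ℕ) (a b y : ℤ) (x : Fin (m + 2) → ℤ),
        StrictMono x → x 0 = a → x (Fin.last (m + 1)) = b → 0 ≤ a → b ≤ y →
        RandomPotential.bridgeQ P V hV 0 y
            {q | q.1 ∈ RandomPotential.reasonableExactly V κ K (Set.Ioo a b)
              (Set.range fun i : Fin m => x i.succ.castSucc)} ≤
          ENNReal.ofReal (∏ j : Fin (m + 1), M₁ * θ ^ (x j.succ - x j.castSucc)) ∧
        RandomPotential.annealedQ P V 0 y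
            {q | q.1 ∈ RandomPotential.reasonableExactly V κ K (Set.Ioo a b)
              (Set.range fun i : Fin m => x i.succ.castSucc)} ≤
          ENNReal.ofReal (∏ j : Fin (m + 1), M₂ * θ ^ (x j.succ - x j.castSucc)) := by
  have hm : Measurable fun ω z => V z ω := measurable_pi_iff.2 hV
  set ν : Measure (ℤ → ℝ≥0∞) := P.map fun ω z => V z ω
  have : IsProbabilityMeasure ν := Measure.isProbabilityMeasure_map hm.aemeasurable
  have hν : IsIIDEnvironment ν := isIIDEnvironment_map hV hindep hident
  have hp : 0 < ν {v | v 0 ∈ Set.Icc (κ : ℝ≥0∞) K} := by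
    have h0 : MeasurableSet {v : ℤ → ℝ≥0∞ | v 0 ∈ Set.Icc (κ : ℝ≥0∞) K} :=
      measurable_pi_apply 0 measurableSet_Icc
    rw [Measure.map_apply hm h0]
    exact hκK
  obtain ⟨M, θ, hθ, hθ1, hbridge⟩ := exists_lintegral_patternBridge_le (K := K) hν hκ hp
  obtain ⟨C, hC⟩ := exists_lintegral_partition_le (K := K) hν hκ hp
  -- The comparison factor `C` is paid once, and `C ≤ (C + 1) ^ (m + 1)` spreads it over the `m + 1`
  -- gaps.
  refine ⟨M, ((C + 1) * M : ℝ≥0), θ, by exact_mod_cast hθ, by exact_mod_cast hθ1, ?_⟩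
  rintro m a b y x hx rfl rfl ha hby
  rw [ofReal_prod_mul_zpow_sub hθ hx, ofReal_prod_mul_zpow_sub hθ hx]
  have hab : x 0 < x (Fin.last (m + 1)) := hx (by simp [Fin.lt_def])
  -- Here `y ≥ 1`, because `0 ≤ a < b ≤ y`.
  obtain ⟨n, rfl⟩ : ∃ n : ℕ, y = ((n + 1 : ℕ) : ℤ) := ⟨(y - 1).toNat, by omega⟩
  set X := Set.range fun i : Fin m => x i.succ.castSucc
  set I := Set.Ioo (x 0) (x (Fin.last (m + 1)))
  have hI : I ⊆ Set.Ico 0 ((n + 1 : ℕ) : ℤ) := fun z hz =>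
    ⟨by have := hz.1; omega, hz.2.trans_le hby⟩
  have hXI : X ⊆ I := by
    rintro _ ⟨i, rfl⟩
    exact ⟨hx (by simp [Fin.lt_def]), hx (by simp [Fin.lt_def])⟩
  have hE : MeasurableSet (reasonableExactly V κ K I X) :=
    measurableSet_reasonableExactly hV κ K I X
  have hmain := hbridge m x hx ha (n + 1) hby
  set D : ℝ≥0∞ := (M : ℝ≥0∞) ^ (m + 1) * (θ : ℝ≥0∞) ^ (x (Fin.last (m + 1)) - x 0).toNat
  have hmean : meanBridge ν (n + 1) ≠ ⊤ :=
    ((meanBridge_le_one _).trans_lt ENNReal.one_lt_top).ne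
  constructor
  · have hden : killedAveraged P V hV 0 (bridgeEvent Ω (n + 1)) = meanBridge ν (n + 1) := by
      have h := killedAveraged_bridgeEvent (P := P) hV n MeasurableSet.univ
      simp only [Set.mem_univ, Set.ofPred_true, Set.inter_univ, Set.indicator_univ] at h
      rw [h, meanBridge, lintegral_map (measurable_bridgeWeight _ _) hm]
    rw [bridgeQ, cond_apply (measurableSet_bridgeEvent (n + 1)), hden,
      killedAveraged_bridgeEvent hV n hE,
      lintegral_indicator_env hV κ K I X (measurable_bridgeWeight 0 (n + 1))]
    exact (mul_le_mul_right hmain _).trans (inv_mul_mul_le le_rfl hmean)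
  · set Z : ℝ≥0∞ := ∫⁻ v, partition v ((n + 1 : ℕ) : ℤ) 0 ∂ν
    have hden : weightedMeasure P V 0 ((n + 1 : ℕ) : ℤ) Set.univ = Z := by
      have h := weightedMeasure_fst (P := P) hV ((n + 1 : ℕ) : ℤ) MeasurableSet.univ
      simp only [Set.mem_univ, Set.ofPred_true, Set.indicator_univ] at h
      rw [h]
      exact (lintegral_map (measurable_partition _ _) hm).symm
    have hZ : Z ≠ ⊤ := by
      refine ne_top_of_le_ne_top ENNReal.one_ne_top ?_
      calc Z ≤ ∫⁻ _, 1 ∂ν := lintegral_mono fun v => partition_le_one v _ 0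
        _ = 1 := by simp
    -- The numerator is bounded through bridges; the normalising constant must therefore dominate
    -- the annealed bridge weight.
    have hle : meanBridge ν (n + 1) ≤ Z :=
      lintegral_mono fun v => bridgeWeight_le_partition v (n + 1)
    have hnum := hC (n + 1) I X (by omega) hI (hXI.trans hI)
    rw [annealedQ, Measure.smul_apply, smul_eq_mul, hden, weightedMeasure_fst hV _ hE,
      lintegral_indicator_env hV κ K I X (measurable_partition ((n + 1 : ℕ) : ℤ) 0)]
    have h1 : (C : ℝ≥0∞) * (D * meanBridge ν (n + 1)) = C * D * meanBridge ν (n + 1) := by ring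
    refine (mul_le_mul_right (hnum.trans ((mul_le_mul_right hmain _).trans h1.le)) _).trans
      ((inv_mul_mul_le hle hZ).trans ?_)
    have h2 : C ≤ (C + 1) ^ (m + 1) :=
      (le_add_of_nonneg_right zero_le_one).trans
        (le_self_pow₀ (le_add_of_nonneg_left zero_le) (by omega))
    rw [← mul_assoc]
    gcongr
    rw [← ENNReal.coe_pow, ← ENNReal.coe_pow, ← ENNReal.coe_mul, ENNReal.coe_le_coe, mul_pow]
    gcongr
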